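/- Let $N,M\ge 0$ be integers. **Phase model.** On the Fock space with basis $|0\rangle,|1\rangle,\dots$ let $\phi|0\rangle=0$, $\phi|k+1\rangle=|k\rangle$, $\phi^\dagger|k\rangle=|k+1\rangle$, and let $\phi_j,\phi_j^\dagger$ be the copies acting on the $j$-th factor of $\mathbb F_0\otimes\dots\otimes\mathbb F_M$. Put $$L_j(u)=\begin{pmatrix}u^{-1}&\phi_j^\dagger\\ \phi_j&u\end{pmatrix},\qquad L_M(u)L_{M-1}(u)\cdots L_0(u)=\begin{pmatrix}A(u)&B(u)\\ C(u)&D(u)\end{pmatrix},$$ and for $u,v\in(\mathbb C\setminus\{0\})^N$ define the scalar product $\mathbb S(N,M|u,v)=\langle 0|C(v_N)\cdots C(v_1)\,B(u_1)\cdots B(u_N)|0\rangle$, where $|0\rangle$ is the vacuum of the tensor product and $\langle 0|$ its dual. **$\tau$-function.** Let $m,n,s$ be integers with $s=n-M=m+N$, so that $m$ and $n$ are free apart from $n-m=N+M$. Let $\Lambda=(\delta_{k+1,l})_{m\le k,l\le n-1}$. Initial data of the finite 2-Toda hierarchy are a matrix $A\in GL(n-m)$ with rows and columns indexed by $m,\dots,n-1$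 and $\det[a_{ij}]_{m\le i,j\le r-1}\neq0$ for $m<r\le n$. The associated 2-Toda $\tau$-function of the time variables $x=(x_1,\dots,x_{n-m-1})$, $y=(y_1,\dots,y_{n-m-1})$ is the minor with rows and columns $m,\dots,s-1$, $$\tau(s,x,y)=\det\Big[\Big(e^{\sum_{k=1}^{n-m-1}x_k\Lambda^k}\,A\,e^{-\sum_{k=1}^{n-m-1}y_k(\Lambda^T)^k}\Big)_{ij}\Big]_{m\le i,j\le s-1}.$$ For partitions $\lambda,\mu\subseteq(M)^N$ (at most $N$ parts, each at most $M$) put $A_{\lambda\mu}=\det[a_{\lambda_{N+1-i}+i+m-1,\;\mu_{N+1-j}+j+m-1}]_{1\le i,j\le N}$ and $\chi_\lambda(x)=\det[\zeta_{\lambda_i+j-i}(x)]_{1\le i,j\le N}$, where $\sum_{k\ge0}z^k\zeta_k(x)=\exp\big(\sum_{k=1}^{n-m-1}z^kx_k\big)$ and $\zeta_k=0$ for $k<0$. Let $p_k(a)=\sum_{j=1}^Na_j^k$, and let $S_\lambda(a_1,\dots,a_N)$ be the Schur polynomial, the sum of $\prod_{c}a_{T(c)}$ over the semistandard tableaux $T$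 of shape $\lambda$ with entries in $\{1,\dots,N\}$. The restricted $\tau$-function $\tau(s,a,b)$, for $a,b\in\mathbb C^N$, is the value of $\tau(s,x,y)$ at $x_k=\frac1kp_k(a)$, $-y_k=\frac1kp_k(b)$, $1\le k\le n-m-1=N+M-1$. **Proposition.** There are initial data $A$ with $A_{\lambda\mu}=\delta_{\lambda\mu}$ for all $\lambda,\mu\subseteq(M)^N$. For $x_k=\frac1kp_k(a)$ one has $\chi_\lambda(x)=S_\lambda(a)$ for all $\lambda\subseteq(M)^N$ and $a\in\mathbb C^N$. For all initial data $A$ with $A_{\lambda\mu}=\delta_{\lambda\mu}$ for all $\lambda,\mu\subseteq(M)^N$: 1. $\tau(s,x,y)=\sum_{\lambda\subseteq(M)^N}\chi_\lambda(x)\,\chi_\lambda(-y)$ for all $x,y$; 2. the restricted $\tau$-function $\tau(s,a,b)$ is a polynomial in $a,b\in\mathbb C^N$ that is symmetric in $a_1,\dots,a_N$ and symmetric in $b_1,\dots,b_N$, and $\tau(s,a,b)=\sum_{\lambda\subseteq(M)^N}S_\lambda(a)\,S_\lambda(b)$; 3. for all $u,v\in(\mathbb C\setminus\{0\})^N$,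 with $u^2=(u_1^2,\dots,u_N^2)$ and $v^{-2}=(v_1^{-2},\dots,v_N^{-2})$, $$\Big(\prod_{j=1}^N\frac{u_j}{v_j}\Big)^{M}\,\mathbb S(N,M|u,v)=\tau(s,u^2,v^{-2}).$$ -/

import Mathlib

open scoped BigOperators TensorProduct

noncomputable section

/-! ### The phase model -/

namespace PhaseModel

/-- One-site Fock space: the complex vector space with basis `|0⟩, |1⟩, |2⟩, …`. -/
abbrev Site : Type := ℕ →₀ ℂ

/-- The basis vector `|k⟩` of the one-site Fock space. -/
def ket (k : ℕ) : Site := Finsupp.single k 1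

/-- The one-site annihilation operator: `φ|0⟩ = 0` and `φ|k+1⟩ = |k⟩`. -/
def phi : Module.End ℂ Site :=
  Finsupp.linearCombination ℂ (fun k : ℕ => if k = 0 then (0 : Site) else ket (k - 1))

/-- The one-site creation operator: `φ†|k⟩ = |k+1⟩`. -/
def phiDag : Module.End ℂ Site :=
  Finsupp.linearCombination ℂ (fun k : ℕ => ket (k + 1))

/-- The Fock space `𝔽₀ ⊗ 𝔽₁ ⊗ ⋯ ⊗ 𝔽_M`. -/
abbrev Fock (M : ℕ) : Type := ⨂[ℂ] _ : Fin (M + 1), Site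

/-- A one-site operator acting on the `j`-th tensor factor, identity on all the others. -/
def atSite (M : ℕ) (j : Fin (M + 1)) (T : Module.End ℂ Site) : Module.End ℂ (Fock M) :=
  PiTensorProduct.map (Function.update (fun _ => LinearMap.id) j T)

/-- The vacuum vector `|0⟩ ⊗ ⋯ ⊗ |0⟩`. -/
def vacuum (M : ℕ) : Fock M := PiTensorProduct.tprod ℂ (fun _ => ket 0)

/-- The conjugate vacuum `⟨0| ⊗ ⋯ ⊗ ⟨0|`, where `⟨0|k⟩ = δ_{0k}` on every site. -/
def vacuumBra (M : ℕ) : Fock M →ₗ[ℂ] ℂ :=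
  PiTensorProduct.lift
    ((MultilinearMap.mkPiAlgebra ℂ (Fin (M + 1)) ℂ).compLinearMap
      (fun _ => (Finsupp.lapply 0 : Site →ₗ[ℂ] ℂ)))

/-- The local operator matrix `L_j(u)`, with rows `(u⁻¹, φ†_j)` and `(φ_j, u)`. -/
def lOperator (M : ℕ) (j : Fin (M + 1)) (u : ℂ) :
    Matrix (Fin 2) (Fin 2) (Module.End ℂ (Fock M)) :=
  !![u⁻¹ • (1 : Module.End ℂ (Fock M)), atSite M j phiDag;
     atSite M j phi, u • (1 : Module.End ℂ (Fock M))]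

/-- The monodromy matrix `T(u) = L_M(u) L_{M-1}(u) ⋯ L_0(u)`. -/
def monodromy (M : ℕ) (u : ℂ) : Matrix (Fin 2) (Fin 2) (Module.End ℂ (Fock M)) :=
  (List.ofFn (fun j : Fin (M + 1) => lOperator M j u)).reverse.prod

/-- The creation operator `B(u)`, the upper right entry of the monodromy matrix. -/
def opB (M : ℕ) (u : ℂ) : Module.End ℂ (Fock M) := monodromy M u 0 1

/-- The annihilation operator `C(u)`, the lower left entry of the monodromy matrix. -/
def opC (M : ℕ) (u : ℂ) : Module.End ℂ (Fock M) := monodromy M u 1 0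

/-- The `N`-particle state `B(u₁) ⋯ B(u_N)|0⟩`. -/
def stateKet (M : ℕ) {N : ℕ} (u : Fin N → ℂ) : Fock M :=
  (List.ofFn (fun j => opB M (u j))).prod (vacuum M)

/-- The conjugate `N`-particle state `⟨0|C(v_N) ⋯ C(v₁)`. -/
def stateBra (M : ℕ) {N : ℕ} (v : Fin N → ℂ) : Fock M →ₗ[ℂ] ℂ :=
  vacuumBra M ∘ₗ (List.ofFn (fun j => opC M (v j))).reverse.prod

/-- The scalar product `S(N, M | u, v) = ⟨0|C(v_N) ⋯ C(v₁) B(u₁) ⋯ B(u_N)|0⟩`. -/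
def scalarProduct (N M : ℕ) (u v : Fin N → ℂ) : ℂ := stateBra M v (stateKet M u)

end PhaseModel

/-! ### Partitions, character polynomials and Schur polynomials -/

namespace Toda

open Classical in
/-- The partitions `λ ⊆ (M)^N`: weakly decreasing sequences of `N` parts, each at most `M`. -/
def boxPartitions (N M : ℕ) : Finset (Fin N → ℕ) :=
  (Fintype.piFinset (fun _ : Fin N => Finset.range (M + 1))).filter Antitone

/-- The one row character polynomial `ζ_k` in the `r` time variables `x₁, …, x_r`:
the coefficient of `z ^ k` in `exp (∑_{j=1}^r x_j z ^ j)`; it is `0` for negative `k`. -/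
def zeta (r : ℕ) (x : ℕ → ℂ) (k : ℤ) : ℂ :=
  if 0 ≤ k then
    PowerSeries.coeff k.toNat
      ((PowerSeries.exp ℂ).subst
        (∑ j ∈ Finset.Icc 1 r, PowerSeries.C (x j) * (PowerSeries.X : PowerSeries ℂ) ^ j))
  else 0

/-- The character polynomial `χ_λ(x) = det [ζ_{λ_i + j - i}(x)]`. -/
def character (r : ℕ) {N : ℕ} (lam : Fin N → ℕ) (x : ℕ → ℂ) : ℂ :=
  Matrix.det (Matrix.of fun i j : Fin N => zeta r x ((lam i : ℤ) + (j : ℤ) - (i : ℤ)))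

/-- The cells of the Young diagram with row lengths `lam`. -/
abbrev Cell {l : ℕ} (lam : Fin l → ℕ) : Type := Σ i : Fin l, Fin (lam i)

/-- A filling of the cells is semistandard if it increases weakly along rows and strictly
down columns. -/
def IsSemistandard {l N : ℕ} {lam : Fin l → ℕ} (T : Cell lam → Fin N) : Prop :=
  (∀ (i : Fin l) (j j' : Fin (lam i)), j ≤ j' → T ⟨i, j⟩ ≤ T ⟨i, j'⟩) ∧
  (∀ (i i' : Fin l) (j : Fin (lam i)) (j' : Fin (lam i')),
    i < i' → (j : ℕ) = (j' : ℕ) → T ⟨i, j⟩ < T ⟨i', j'⟩)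

open Classical in
/-- The Schur polynomial `S_λ(a₁, …, a_N)`: the sum over the semistandard tableaux of shape `λ`
with entries in `{1, …, N}` of the product of the variables at the entries. -/
def schur {l N : ℕ} (lam : Fin l → ℕ) (a : Fin N → ℂ) : ℂ :=
  ∑ T ∈ (Finset.univ : Finset (Cell lam → Fin N)).filter IsSemistandard, ∏ c, a (T c)

/-! ### The `τ`-function of the finite 2-Toda hierarchy -/

/-- `gl(n - m)`, with rows and columns indexed by `m, m + 1, …, n - 1`. -/
abbrev Mat (m n : ℤ) : Type := Matrix (Finset.Ico m n) (Finset.Ico m n) ℂ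

/-- The shift matrix `Λ = (δ_{k+1,l})`. -/
def shift (m n : ℤ) : Mat m n :=
  Matrix.of fun k l => if (k : ℤ) + 1 = (l : ℤ) then 1 else 0

/-- The number `n - m - 1` of time variables in each of the two sets. -/
def numTimes (m n : ℤ) : ℕ := (n - m - 1).toNat

/-- The `(i, j)` entry of a matrix indexed by `m, …, n - 1`; only used for `i`, `j` in that range,
and `0` otherwise. -/
def entry {m n : ℤ} (A : Mat m n) (i j : ℤ) : ℂ :=
  if h : i ∈ Finset.Ico m n ∧ j ∈ Finset.Ico m n then A ⟨i, h.1⟩ ⟨j, h.2⟩ else 0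

/-- The leading minor `det [a_{ij}]_{m ≤ i, j ≤ s - 1}`. -/
def leadingMinor {m n : ℤ} (A : Mat m n) (s : ℤ) : ℂ :=
  Matrix.det (Matrix.of fun i j : Fin (s - m).toNat => entry A (m + (i : ℤ)) (m + (j : ℤ)))

/-- Initial data of the hierarchy: `A ∈ GL(n - m)` whose leading minors do not vanish. -/
def IsInitialData {m n : ℤ} (A : Mat m n) : Prop :=
  IsUnit A ∧ ∀ s : ℤ, m < s → s ≤ n → leadingMinor A s ≠ 0

/-- The time evolution `A(x, y) = exp (∑ x_k Λ ^ k) A exp (- ∑ y_k (Λᵀ) ^ k)`,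
`1 ≤ k ≤ n - m - 1`. -/
def evolved {m n : ℤ} (A : Mat m n) (x y : ℕ → ℂ) : Mat m n :=
  NormedSpace.exp (∑ k ∈ Finset.Icc 1 (numTimes m n), x k • shift m n ^ k) * A *
    NormedSpace.exp (-∑ k ∈ Finset.Icc 1 (numTimes m n), y k • (shift m n).transpose ^ k)

/-- The 2-Toda `τ`-function with initial data `A`:
`τ(s, x, y) = det [a_{ij}(x, y)]_{m ≤ i, j ≤ s - 1}`. -/
def tau {m n : ℤ} (A : Mat m n) (s : ℤ) (x y : ℕ → ℂ) : ℂ := leadingMinor (evolved A x y) s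

/-- The coefficient `A_{λμ}`, the minor of `A` with rows `λ_{N+1-i} + i + m - 1` and columns
`μ_{N+1-j} + j + m - 1`, where `1 ≤ i, j ≤ N` (here `i` and `j` are counted from `0`). -/
def coefficient {m n : ℤ} (A : Mat m n) {N : ℕ} (lam mu : Fin N → ℕ) : ℂ :=
  Matrix.det (Matrix.of fun i j : Fin N =>
    entry A (m + (i : ℤ) + (lam i.rev : ℤ)) (m + (j : ℤ) + (mu j.rev : ℤ)))

/-- Normalized power sums `p_k(a₁, …, a_N) / k`, `k ≥ 1`. -/
def powerSumTimes {N : ℕ} (a : Fin N → ℂ) (k : ℕ) : ℂ := (1 / (k : ℂ)) * ∑ j, a j ^ k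

/-- The restricted `τ`-function: the time variables are specialized to
`x_k = p_k(a) / k` and `- y_k = p_k(b) / k`. -/
def restrictedTau {m n : ℤ} (A : Mat m n) (s : ℤ) {N : ℕ} (a b : Fin N → ℂ) : ℂ :=
  tau A s (powerSumTimes a) (-powerSumTimes b)

end Toda

end

/-!
Everything is expressed through the minors `minor f ν λ` of the Toeplitz matrix of a power series
`f`, whose rows and columns are labelled by partitions in the box `(M)^N`: the partition `λ`
selects the strictly increasing sequence `position λ`. By the Cauchy–Binet formula
(`det_sum_eq_sum_boxPartitions`) these minors are multiplicative in `f` (`minor_mul`). For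
`f = (1 - aX)⁻¹` the minor is `a ^ (|λ| - |ν|)` if `λ/ν` is a horizontal strip and `0` otherwise
(`minor_geom`). So a quantity that picks up the factor `a ^ (|λ| - |ν|)` over horizontal strips
when a variable `a` is added is the minor `minor (∏ (1 - a_j X)⁻¹) 0 λ`. This is applied twice.

* The cells of a semistandard tableau with the largest entry form a horizontal strip, which gives
  the Jacobi–Trudi formula `schur_eq_minor`. The character polynomials are minors by definition,
  with symbol `exp (∑ x_k X ^ k)`. When `x_k = p_k(a) / k`, this symbol agrees with
  `∏ (1 - a_j X)⁻¹` up to the order that the box can see, because the logarithmic derivatives agree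
  (`coeff_zetaSeries_powerSumTimes`). Hence character polynomials restrict to Schur polynomials.
* Expanding the monodromy matrix into paths through the sites, `B(u)` maps the basis vector labelled
  by `μ` to the sum of `u ^ (-M) * u ^ (2 * (|λ| - |μ|))` times the vectors labelled by `λ`, over
  the horizontal strips `λ/μ` (`opB_fockBasis`): in terms of columns, a horizontal strip adds at
  most one cell to each column, and the path records which columns grow. Hence the coefficients of
  `B(u_1) ⋯ B(u_N)|0⟩` are Schur polynomials in the `u_j ^ 2` (`stateKet_eq_sum`). Since `C(v)` is
  the transpose of `B(v⁻¹)` (`toDual_opB`), the scalar product is the sum of `S_λ(u²) S_λ(v⁻²)`.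

For the `τ`-function, `exp (∑ x_k Λ ^ k)` is itself the Toeplitz matrix with symbol
`exp (∑ x_k X ^ k)` (`exp_toeplitzHom`), so two applications of Cauchy–Binet expand `τ` in products
of character polynomials with the coefficients `A_{λμ}` (`tau_eq_sum_coefficient`). The identity
matrix is initial data with `A_{λμ} = δ_{λμ}`.
-/

noncomputable section

namespace Toda

/-! ### Partitions in a box and strictly increasing sequences -/

lemma mem_boxPartitions {N M : ℕ} {lam : Fin N → ℕ} :
    lam ∈ boxPartitions N M ↔ (∀ i, lam i ≤ M) ∧ Antitone lam := by
  simp [boxPartitions, Fintype.mem_piFinset]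

/-- The strictly increasing sequence `λ_{N-i} + i`, `0 ≤ i < N`, attached to a partition `λ` with
parts `λ_1 ≥ … ≥ λ_N`; this is how partitions label the maximal minors of a matrix. -/
def position {N : ℕ} (lam : Fin N → ℕ) (i : Fin N) : ℕ := lam i.rev + i

lemma position_lt {N M : ℕ} {lam : Fin N → ℕ} (h : lam ∈ boxPartitions N M) (i : Fin N) :
    position lam i < N + M := by
  have := (mem_boxPartitions.1 h).1 i.rev
  have := i.2
  unfold position; omega

lemma position_strictMono {N : ℕ} {lam : Fin N → ℕ} (h : Antitone lam) :
    StrictMono (position lam) := by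
  intro i j hij
  have := h (Fin.rev_le_rev.2 hij.le)
  have : (i : ℕ) < j := hij
  unfold position; omega

lemma position_injective {N : ℕ} : Function.Injective (position (N := N)) := by
  intro lam mu h
  funext i
  have := congrFun h i.rev
  simpa [position] using this

lemma exists_position_eq {N M : ℕ} {g : Fin N → ℕ} (hg : StrictMono g) (hlt : ∀ i, g i < N + M) :
    ∃ lam ∈ boxPartitions N M, position lam = g := by
  have step : ∀ (d : ℕ) (i j : Fin N), (j : ℕ) = i + d → g i + d ≤ g j := by
    intro d
    induction d with
    | zero => intro i j h; rw [Fin.ext (by simpa using h) (a := j) (b := i)]; simp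
    | succ d ih =>
      intro i j h
      have hj := j.2
      have h1 := ih i ⟨i + d, by omega⟩ rfl
      have h2 : g ⟨i + d, by omega⟩ < g j := hg (by rw [Fin.lt_def]; simp; omega)
      omega
  have low : ∀ i : Fin N, (i : ℕ) ≤ g i := by
    intro i
    have := i.2
    have := step i ⟨0, by omega⟩ i (by simp)
    omega
  refine ⟨fun i => g i.rev - i.rev, mem_boxPartitions.2 ⟨fun i => ?_, fun i j hij => ?_⟩, ?_⟩
  · have h0 := i.rev.2
    have h1 := step (N - 1 - i.rev) i.rev ⟨N - 1, by omega⟩ (by simp; omega)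
    have h2 := hlt ⟨N - 1, by omega⟩
    have := low i.rev
    omega
  · have h1 : (j.rev : ℕ) ≤ i.rev := Fin.rev_le_rev.2 hij
    have := step (i.rev - j.rev) j.rev i.rev (by omega)
    have := low i.rev
    have := low j.rev
    change g j.rev - j.rev ≤ g i.rev - i.rev
    omega
  · funext i
    have := low i
    simp [position]; omega

/-! ### The Cauchy–Binet formula -/

lemma det_sum_eq_sum_piFinset {R : Type*} [CommRing R] {N : ℕ} (s : Finset ℕ) (P : Fin N → ℕ → R)
    (Q : ℕ → Fin N → R) :
    Matrix.det (Matrix.of fun i j => ∑ t ∈ s, P i t * Q t j) =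
      ∑ f ∈ Fintype.piFinset (fun _ : Fin N => s),
        (∏ i, P i (f i)) * Matrix.det (Matrix.of fun i j => Q (f i) j) := by
  have h := (Matrix.detRowAlternating (R := R) (n := Fin N)).toMultilinearMap.map_sum_finset
    (fun i t => P i t • Q t) (fun _ => s)
  have e : (Matrix.of fun i j => ∑ t ∈ s, P i t * Q t j) =
      Matrix.of (fun i => ∑ t ∈ s, P i t • Q t) := by
    ext i j; simp [Finset.sum_apply]
  rw [e]
  refine h.trans (Finset.sum_congr rfl fun f _ => ?_)
  rw [MultilinearMap.map_smul_univ]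
  rfl

/-- The Cauchy–Binet formula, with the subsets of the summation range labelled by partitions. -/
theorem det_sum_eq_sum_boxPartitions {R : Type*} [CommRing R] {N : ℕ} (M : ℕ) (P : Fin N → ℕ → R)
    (Q : ℕ → Fin N → R) :
    Matrix.det (Matrix.of fun i j => ∑ t ∈ Finset.range (N + M), P i t * Q t j) =
      ∑ mu ∈ boxPartitions N M,
        Matrix.det (Matrix.of fun i j => P i (position mu j)) *
          Matrix.det (Matrix.of fun i j => Q (position mu i) j) := by
  classical
  have hR : ∀ mu : Fin N → ℕ, Matrix.det (Matrix.of fun i j => P i (position mu j)) *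
          Matrix.det (Matrix.of fun i j => Q (position mu i) j) =
      ∑ σ : Equiv.Perm (Fin N), (∏ i, P i (position mu (σ i))) *
        Matrix.det (Matrix.of fun i j => Q (position mu (σ i)) j) := by
    intro mu
    rw [← Matrix.det_transpose, Matrix.det_apply', Finset.sum_mul]
    refine Finset.sum_congr rfl fun σ _ => ?_
    have := Matrix.det_permute σ (Matrix.of fun i j => Q (position mu i) j)
    have e : (Matrix.of fun i j => Q (position mu i) j).submatrix σ id =
      Matrix.of fun i j => Q (position mu (σ i)) j := rfl
    rw [e] at this
    rw [this]
    simp only [Matrix.transpose_apply, Matrix.of_apply]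
    ring
  rw [det_sum_eq_sum_piFinset, Finset.sum_congr rfl (fun mu _ => hR mu), ← Finset.sum_product']
  symm
  -- a term on the other side vanishes unless `f` is injective, i.e. a rearrangement of a
  -- strictly increasing sequence
  refine Finset.sum_bij_ne_zero (fun p _ _ => position p.1 ∘ p.2) ?_ ?_ ?_ ?_
  · rintro ⟨mu, σ⟩ h -
    exact Fintype.mem_piFinset.2 fun i => Finset.mem_range.2
      (position_lt (Finset.mem_product.1 h).1 _)
  · rintro ⟨mu, σ⟩ h - ⟨nu, ρ⟩ h' - e
    have hm := position_strictMono (mem_boxPartitions.1 (Finset.mem_product.1 h).1).2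
    have hn := position_strictMono (mem_boxPartitions.1 (Finset.mem_product.1 h').1).2
    simp only at e hm hn
    have hr : Set.range (position mu) = Set.range (position nu) := by
      rw [← EquivLike.range_comp (position mu) σ, ← EquivLike.range_comp (position nu) ρ]
      exact congrArg Set.range e
    have e1 : position mu = position nu := (StrictMono.range_inj hm hn).1 hr
    have e2 : mu = nu := position_injective e1
    subst e2
    refine Prod.ext rfl (Equiv.ext fun i => hm.injective (congrFun e i))
  · intro f hf hne
    have hinj : Function.Injective f := by
      intro i j hij
      by_contra hne'
      exact hne (by rw [Matrix.det_zero_of_row_eq hne' (by ext k; simp [hij]), mul_zero])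
    have hs : StrictMono (f ∘ Tuple.sort f) :=
      (Tuple.monotone_sort f).strictMono_of_injective (hinj.comp (Tuple.sort f).injective)
    obtain ⟨mu, hmu, e⟩ := exists_position_eq (M := M) hs fun i =>
      Finset.mem_range.1 (Fintype.mem_piFinset.1 hf _)
    have e' : position mu ∘ ⇑(Tuple.sort f)⁻¹ = f := by
      rw [e]; funext i; simp
    have e'' : ∀ i, position mu ((Tuple.sort f)⁻¹ i) = f i := congrFun e'
    refine ⟨(mu, (Tuple.sort f)⁻¹), by simp [hmu], ?_, e'⟩
    simp only [e'']
    exact hne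
  · rintro ⟨mu, σ⟩ - -
    rfl

/-! ### Minors of Toeplitz matrices -/

/-- The entries of the upper triangular Toeplitz matrix with symbol `f`. -/
def toeplitz (f : PowerSeries ℂ) (k l : ℕ) : ℂ := if k ≤ l then PowerSeries.coeff (l - k) f else 0

lemma sum_toeplitz_mul_toeplitz (f g : PowerSeries ℂ) {k l K : ℕ} (hl : l < K) :
    ∑ t ∈ Finset.range K, toeplitz f k t * toeplitz g t l = toeplitz (f * g) k l := by
  unfold toeplitz
  split_ifs with hkl
  · rw [PowerSeries.coeff_mul, Finset.Nat.sum_antidiagonal_eq_sum_range_succ_mk]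
    symm
    refine Finset.sum_bij_ne_zero (fun d _ _ => k + d) ?_ ?_ ?_ ?_
    · intro d hd _
      simp at hd ⊢; omega
    · intro d _ _ d' _ _ h
      omega
    · intro t _ h
      have h1 : k ≤ t := by by_contra h'; simp [h'] at h
      have h2 : t ≤ l := by by_contra h'; simp [h'] at h
      refine ⟨t - k, by simp; omega, ?_, by omega⟩
      rw [if_pos h1, if_pos h2] at h
      rwa [show l - k - (t - k) = l - t by omega]
    · intro d hd _
      have : d ≤ l - k := by simp at hd; omega
      rw [if_pos (by omega), if_pos (by omega)]
      congr 3 <;> omega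
  · refine Finset.sum_eq_zero fun t _ => ?_
    by_cases h1 : k ≤ t
    · rw [if_neg (c := t ≤ l) (by omega), mul_zero]
    · rw [if_neg h1, zero_mul]

/-- The minor of the Toeplitz matrix with symbol `f` with rows labelled by the partition `nu` and
columns labelled by `lam`: a skew Schur function `s_{λ/ν}` in Jacobi–Trudi form. -/
def minor (f : PowerSeries ℂ) {N : ℕ} (nu lam : Fin N → ℕ) : ℂ :=
  Matrix.det (Matrix.of fun i j => toeplitz f (position nu i) (position lam j))

lemma minor_mul (f g : PowerSeries ℂ) {N M : ℕ} (nu : Fin N → ℕ) {lam : Fin N → ℕ}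
    (h : lam ∈ boxPartitions N M) :
    minor (f * g) nu lam = ∑ mu ∈ boxPartitions N M, minor f nu mu * minor g mu lam := by
  unfold minor
  rw [← det_sum_eq_sum_boxPartitions M (fun i t => toeplitz f (position nu i) t)
    (fun t j => toeplitz g t (position lam j))]
  congr 1
  ext i j
  exact (sum_toeplitz_mul_toeplitz f g (position_lt h j)).symm

/-! ### Horizontal strips and the one-variable minors -/

/-- `λ/ν` is a horizontal strip: `λ_1 ≥ ν_1 ≥ λ_2 ≥ ν_2 ≥ …`. -/
def IsHorizontalStrip {N : ℕ} (nu lam : Fin N → ℕ) : Prop :=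
  (∀ i, nu i ≤ lam i) ∧ ∀ i j, i < j → lam j ≤ nu i

lemma IsHorizontalStrip.mem_boxPartitions {N M : ℕ} {nu lam : Fin N → ℕ}
    (h : IsHorizontalStrip nu lam) (hlam : lam ∈ boxPartitions N M) :
    nu ∈ boxPartitions N M := by
  refine Toda.mem_boxPartitions.2 ⟨fun i => (h.1 i).trans ((Toda.mem_boxPartitions.1 hlam).1 i),
    fun i j hij => ?_⟩
  rcases hij.eq_or_lt with rfl | hij
  · exact le_rfl
  · exact (h.1 j).trans (h.2 i j hij)

/-- The geometric series `(1 - aX)⁻¹`. -/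
def geom (a : ℂ) : PowerSeries ℂ := PowerSeries.mk fun k => a ^ k

lemma toeplitz_geom (a : ℂ) (k l : ℕ) :
    toeplitz (geom a) k l = if k ≤ l then a ^ (l - k) else 0 := by
  simp [toeplitz, geom]

lemma geom_zero : geom 0 = 1 := by
  ext k
  simp [geom, PowerSeries.coeff_one, zero_pow_eq]

lemma geom_mul (a : ℂ) : geom a * (1 - PowerSeries.C a * PowerSeries.X) = 1 := by
  ext k
  cases k with
  | zero => simp [geom, mul_sub]
  | succ k =>
    rw [mul_sub, mul_one, ← mul_assoc, map_sub, PowerSeries.coeff_succ_mul_X,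
      PowerSeries.coeff_mul_C]
    simp [geom, PowerSeries.coeff_one, pow_succ]

/-- A matrix with a zero block of size `(N - i) × (i + 1)` is singular. -/
lemma det_eq_zero_of_zero_block {R : Type*} [CommRing R] {N : ℕ} (A : Matrix (Fin N) (Fin N) R)
    (i : Fin N) (h : ∀ k l, i ≤ k → l ≤ i → A k l = 0) : A.det = 0 := by
  rw [Matrix.det_apply']
  refine Finset.sum_eq_zero fun σ _ => ?_
  obtain ⟨l, hl, hσ⟩ : ∃ l, l ≤ i ∧ i ≤ σ l := by
    by_contra! hcon
    have := Finset.card_le_card_of_injOn (s := Finset.Iic i) (t := Finset.Iio i) σ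
      (fun l hl => by simpa using hcon l (by simpa using hl)) σ.injective.injOn
    simp at this
  rw [Finset.prod_eq_zero (f := fun l => A (σ l) l) (Finset.mem_univ l) (h _ _ hσ hl), mul_zero]

open Classical in
/-- The skew Schur function `s_{λ/ν}` in one variable. -/
theorem minor_geom (a : ℂ) {N : ℕ} {nu lam : Fin N → ℕ} (hnu : Antitone nu) (hlam : Antitone lam) :
    minor (geom a) nu lam =
      if IsHorizontalStrip nu lam then a ^ ∑ i, (lam i - nu i) else 0 := by
  have hp := position_strictMono hnu
  have hq := position_strictMono hlam
  set p := position nu with hpdef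
  set q := position lam with hqdef
  have hpi : ∀ i, p i = nu i.rev + i := fun i => rfl
  have hqi : ∀ i, q i = lam i.rev + i := fun i => rfl
  have hstrip : IsHorizontalStrip nu lam ↔ (∀ i, p i ≤ q i) ∧ ∀ i j, i < j → q i < p j := by
    constructor
    · rintro ⟨h1, h2⟩
      refine ⟨fun i => by have := h1 i.rev; rw [hpi, hqi]; omega, fun i j hij => ?_⟩
      have := h2 j.rev i.rev (Fin.rev_lt_rev.2 hij)
      have : (i : ℕ) < j := hij
      rw [hpi, hqi]; omega
    · rintro ⟨h1, h2⟩
      refine ⟨fun i => ?_, fun i j hij => ?_⟩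
      · have := h1 i.rev
        rw [hpi, hqi, Fin.rev_rev] at this; omega
      · have hij' : (i : ℕ) < j := hij
        have hj := j.2
        -- compare `λ_j` with `ν_{j-1}`, the immediate neighbour, which is at most `ν_i`
        have h3 := h2 j.rev (Fin.rev ⟨j - 1, by omega⟩) (by
          rw [Fin.rev_lt_rev, Fin.lt_def]; simp only; omega)
        rw [hpi, hqi, Fin.rev_rev, Fin.rev_rev] at h3
        have h4 : nu ⟨j - 1, by omega⟩ ≤ nu i := hnu (by rw [Fin.le_def]; simp only; omega)
        simp only [Fin.val_rev] at h3
        omega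
  unfold minor
  rw [← hpdef, ← hqdef]
  split_ifs with h
  · obtain ⟨h1, h2⟩ := hstrip.1 h
    rw [Matrix.det_of_isUpperTriangular]
    · rw [← Finset.prod_pow_eq_pow_sum, ← Equiv.prod_comp Fin.revPerm]
      refine Finset.prod_congr rfl fun i _ => ?_
      have h1i := h1 (Fin.revPerm i)
      rw [Matrix.of_apply, toeplitz_geom, if_pos h1i]
      congr 1
      rw [hpi, hqi, Fin.revPerm_apply, Fin.rev_rev]; omega
    · intro i j hij
      rw [Matrix.of_apply, toeplitz_geom, if_neg (by have := h2 j i hij; omega)]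
  · rw [hstrip, not_and_or] at h
    by_cases h1 : ∀ i, p i ≤ q i
    · have h2 := h.resolve_left (not_not.2 h1)
      push Not at h2
      -- for the least `i` such that `p j ≤ q i` for some `j > i`, the rows `i` and `j` are
      -- proportional
      let S := Finset.univ.filter fun i : Fin N => ∃ j, i < j ∧ p j ≤ q i
      have hS : S.Nonempty := by
        obtain ⟨i, j, hij⟩ := h2
        exact ⟨i, by simp only [S, Finset.mem_filter, Finset.mem_univ, true_and]; exact ⟨j, hij⟩⟩
      obtain ⟨i, hi, hmin⟩ := S.exists_min_image id hS
      simp only [S, Finset.mem_filter, Finset.mem_univ, true_and, id] at hi hmin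
      obtain ⟨j, hij, hji⟩ := hi
      refine Matrix.exists_vecMul_eq_zero_iff.1
        ⟨Pi.single i 1 - Pi.single j (a ^ (p j - p i)), fun h0 => ?_, ?_⟩
      · have := congrFun h0 i
        simp [hij.ne] at this
      · ext l
        have hpij := hp hij
        rw [Matrix.sub_vecMul, Pi.sub_apply, Matrix.single_vecMul, Matrix.single_vecMul]
        simp only [Pi.smul_apply, Matrix.row_apply, Matrix.of_apply, toeplitz_geom,
          smul_eq_mul, Pi.zero_apply]
        by_cases hl : l < i
        · have h3 : ∀ r, l < r → ¬ p r ≤ q l := fun r hr hle =>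
            absurd (hmin l ⟨r, hr, hle⟩) (not_le.2 hl)
          rw [if_neg (h3 i hl), if_neg (h3 j (hl.trans hij))]; simp
        · have h4 : q i ≤ q l := hq.monotone (not_lt.1 hl)
          have h5 : p j ≤ q l := hji.trans h4
          rw [if_pos (hpij.le.trans h5), if_pos h5,
            show q l - p i = (p j - p i) + (q l - p j) by omega, pow_add]
          ring
    · push Not at h1
      obtain ⟨i, hi⟩ := h1
      refine det_eq_zero_of_zero_block _ i fun k l hk hl => ?_
      have h3 := hp.monotone hk
      have h4 := hq.monotone hl
      rw [Matrix.of_apply, toeplitz_geom, if_neg (by omega)]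

lemma minor_one {N : ℕ} {nu lam : Fin N → ℕ} (hnu : Antitone nu) (hlam : Antitone lam) :
    minor 1 nu lam = if nu = lam then 1 else 0 := by
  rw [← geom_zero, minor_geom 0 hnu hlam]
  by_cases h : nu = lam
  · subst h
    rw [if_pos ⟨fun _ => le_rfl, fun _ _ h => hnu h.le⟩]
    simp
  · rw [if_neg h]
    split_ifs with hs
    · refine zero_pow fun h0 => h (funext fun i => (hs.1 i).antisymm ?_)
      exact Nat.sub_eq_zero_iff_le.1 (Finset.sum_eq_zero_iff.1 h0 i (Finset.mem_univ i))
    · rfl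

/-! ### Schur polynomials as Toeplitz minors -/

/-- An initial segment of `Fin n` is determined by its cardinality. -/
lemma lt_card_filter_iff {n : ℕ} (p : Fin n → Prop) [DecidablePred p]
    (hp : ∀ i j, i ≤ j → p j → p i) (j : Fin n) :
    (j : ℕ) < (Finset.univ.filter p).card ↔ p j := by
  constructor
  · intro h
    by_contra hj
    have := Finset.card_le_card (s := Finset.univ.filter p) (t := Finset.Iio j) fun i hi => by
      simp only [Finset.mem_filter, Finset.mem_univ, true_and] at hi
      rw [Finset.mem_Iio]
      by_contra hij
      exact hj (hp j i (not_lt.1 hij) hi)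
    rw [Fin.card_Iio] at this
    omega
  · intro h
    have := Finset.card_le_card (s := Finset.Iic j) (t := Finset.univ.filter p) fun i hi => by
      simpa using hp i j (Finset.mem_Iic.1 hi) h
    rw [Fin.card_Iic] at this
    omega

lemma card_filter_val_lt {m n : ℕ} (h : m ≤ n) :
    (Finset.univ.filter fun j : Fin n => (j : ℕ) < m).card = m := by
  obtain ⟨d, rfl⟩ := Nat.exists_eq_add_of_le h
  have : (Finset.univ.filter fun j : Fin (m + d) => (j : ℕ) < m) =
      Finset.univ.map (Fin.castAddEmb d) := by
    ext j
    simp only [Finset.mem_filter, Finset.mem_univ, true_and, Finset.mem_map, Fin.castAddEmb_apply]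
    exact ⟨fun hj => ⟨⟨j, hj⟩, rfl⟩, by rintro ⟨i, rfl⟩; exact i.2⟩
  rw [this]; simp

lemma prod_dite_lt {m n : ℕ} (h : m ≤ n) (f : Fin m → ℂ) (c : ℂ) :
    ∏ j : Fin n, (if hj : (j : ℕ) < m then f ⟨j, hj⟩ else c) = (∏ j, f j) * c ^ (n - m) := by
  obtain ⟨d, rfl⟩ := Nat.exists_eq_add_of_le h
  rw [Fin.prod_univ_add]
  simp

/-- The subdiagram of the cells whose entry is not the largest one, as a sequence of row lengths. -/
def innerShape {l k : ℕ} {lam : Fin l → ℕ} (T : Cell lam → Fin (k + 1)) (i : Fin l) : ℕ :=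
  (Finset.univ.filter fun j : Fin (lam i) => T ⟨i, j⟩ ≠ Fin.last k).card

/-- The filling of `lam` which extends a filling of `mu` by the largest entry. -/
def extendFilling {l k : ℕ} {mu : Fin l → ℕ} (lam : Fin l → ℕ) (T : Cell mu → Fin k) :
    Cell lam → Fin (k + 1) := fun c =>
  if h : (c.2 : ℕ) < mu c.1 then (T ⟨c.1, ⟨c.2, h⟩⟩).castSucc else Fin.last k

lemma lt_innerShape_iff {l k : ℕ} {lam : Fin l → ℕ} {T : Cell lam → Fin (k + 1)}
    (hT : IsSemistandard T) (i : Fin l) (j : Fin (lam i)) :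
    (j : ℕ) < innerShape T i ↔ T ⟨i, j⟩ ≠ Fin.last k := by
  refine lt_card_filter_iff (fun j : Fin (lam i) => T ⟨i, j⟩ ≠ Fin.last k) ?_ j
  intro j j' hjj' h
  have := hT.1 i j j' hjj'
  exact (lt_of_le_of_lt this (Fin.lt_last_iff_ne_last.2 h)).ne

lemma innerShape_strip {l k : ℕ} {lam : Fin l → ℕ} (hlam : Antitone lam)
    {T : Cell lam → Fin (k + 1)} (hT : IsSemistandard T) :
    IsHorizontalStrip (innerShape T) lam := by
  refine ⟨fun i => (Finset.card_filter_le _ _).trans (by simp), fun i i' hii' => ?_⟩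
  by_contra! hlt
  have h1 : innerShape T i < lam i := hlt.trans_le (hlam hii'.le)
  have h2 : T ⟨i, ⟨innerShape T i, h1⟩⟩ = Fin.last k := by
    by_contra hne
    exact lt_irrefl _ ((lt_innerShape_iff hT i ⟨innerShape T i, h1⟩).2 hne)
  have := hT.2 i i' ⟨innerShape T i, h1⟩ ⟨innerShape T i, hlt⟩ hii' rfl
  rw [h2] at this
  exact absurd (Fin.le_last _) (not_le.2 this)

lemma extendFilling_semistandard {l k : ℕ} {mu lam : Fin l → ℕ}
    (h : IsHorizontalStrip mu lam) {T : Cell mu → Fin k} (hT : IsSemistandard T) :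
    IsSemistandard (extendFilling lam T) := by
  refine ⟨fun i j j' hjj' => ?_, fun i i' j j' hii' hjj' => ?_⟩
  · unfold extendFilling
    have hjj : (j : ℕ) ≤ j' := hjj'
    by_cases h' : (j' : ℕ) < mu i
    · simp only [h', hjj.trans_lt h', dite_true]
      exact Fin.castSucc_le_castSucc_iff.2 (hT.1 _ _ _ hjj)
    · simp only [h', dite_false]
      exact Fin.le_last _
  · have h1 : (j : ℕ) < mu i := by
      have := h.2 i i' hii'
      have := j'.2
      omega
    unfold extendFilling
    by_cases h' : (j' : ℕ) < mu i'
    · simp only [h', h1, dite_true]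
      exact Fin.castSucc_lt_castSucc_iff.2 (hT.2 _ _ _ _ hii' hjj')
    · simp only [h', h1, dite_true, dite_false]
      exact Fin.castSucc_lt_last _

lemma innerShape_extendFilling {l k : ℕ} {mu lam : Fin l → ℕ} (h : ∀ i, mu i ≤ lam i)
    (T : Cell mu → Fin k) : innerShape (extendFilling lam T) = mu := by
  funext i
  unfold innerShape
  rw [← card_filter_val_lt (h i)]
  congr 1
  ext j
  simp only [Finset.mem_filter, Finset.mem_univ, true_and]
  unfold extendFilling
  split_ifs with hj
  · simpa using hj
  · simpa using hj

lemma extendFilling_injective {l k : ℕ} {mu lam : Fin l → ℕ} (h : ∀ i, mu i ≤ lam i) :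
    Function.Injective (extendFilling (k := k) (mu := mu) lam) := by
  intro T T' e
  funext ⟨i, j⟩
  have := congrFun e ⟨i, ⟨j, j.2.trans_le (h i)⟩⟩
  simpa [extendFilling] using this

lemma exists_extendFilling_eq {l k : ℕ} {lam : Fin l → ℕ} {T : Cell lam → Fin (k + 1)}
    (hT : IsSemistandard T) {mu : Fin l → ℕ} (hmu : innerShape T = mu) (h : ∀ i, mu i ≤ lam i) :
    ∃ T' : Cell mu → Fin k, IsSemistandard T' ∧ extendFilling lam T' = T := by
  subst hmu
  have key : ∀ i (j : Fin (innerShape T i)), T ⟨i, ⟨j, j.2.trans_le (h i)⟩⟩ ≠ Fin.last k :=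
    fun i j => (lt_innerShape_iff hT i _).1 j.2
  refine ⟨fun c => (T ⟨c.1, ⟨c.2, c.2.2.trans_le (h c.1)⟩⟩).castPred (key c.1 c.2), ⟨?_, ?_⟩, ?_⟩
  · intro i j j' hjj'
    exact Fin.castPred_le_castPred_iff.2 (hT.1 _ _ _ hjj')
  · intro i i' j j' hii' hjj'
    exact Fin.castPred_lt_castPred_iff.2 (hT.2 _ _ _ _ hii' hjj')
  · funext ⟨i, j⟩
    unfold extendFilling
    split_ifs with hj
    · simp
    · exact (not_not.1 fun hne => hj ((lt_innerShape_iff hT i j).2 hne)).symm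

lemma prod_extendFilling {l k : ℕ} {mu lam : Fin l → ℕ} (h : ∀ i, mu i ≤ lam i)
    (T : Cell mu → Fin k) (a : Fin (k + 1) → ℂ) :
    ∏ c, a (extendFilling lam T c) =
      (∏ c, a (T c).castSucc) * a (Fin.last k) ^ ∑ i, (lam i - mu i) := by
  rw [Fintype.prod_sigma, Fintype.prod_sigma, ← Finset.prod_pow_eq_pow_sum,
    ← Finset.prod_mul_distrib]
  refine Finset.prod_congr rfl fun i _ => ?_
  rw [← prod_dite_lt (h i) (fun j => a (T ⟨i, j⟩).castSucc)]
  refine Finset.prod_congr rfl fun j _ => ?_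
  unfold extendFilling
  split_ifs <;> rfl

open Classical in
/-- The branching rule for Schur polynomials: the cells with the largest entry of a semistandard
tableau form a horizontal strip. -/
lemma schur_succ {l k M : ℕ} {lam : Fin l → ℕ} (hlam : lam ∈ boxPartitions l M)
    (a : Fin (k + 1) → ℂ) :
    schur lam a = ∑ mu ∈ boxPartitions l M, schur mu (fun j => a j.castSucc) *
      if IsHorizontalStrip mu lam then a (Fin.last k) ^ ∑ i, (lam i - mu i) else 0 := by
  have hanti := (mem_boxPartitions.1 hlam).2
  unfold schur
  rw [← Finset.sum_fiberwise_of_maps_to (t := boxPartitions l M) (g := innerShape)]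
  · refine Finset.sum_congr rfl fun mu _ => ?_
    split_ifs with h
    · rw [Finset.sum_mul]
      symm
      refine Finset.sum_bij (fun T _ => extendFilling lam T) ?_ ?_ ?_ ?_
      · intro T hT
        simp only [Finset.mem_filter, Finset.mem_univ, true_and] at hT ⊢
        exact ⟨extendFilling_semistandard h hT,
          innerShape_extendFilling h.1 T⟩
      · intro T _ T' _ e
        exact extendFilling_injective h.1 e
      · intro T hT
        simp only [Finset.mem_filter, Finset.mem_univ, true_and] at hT
        obtain ⟨T', h1, h2⟩ := exists_extendFilling_eq hT.1 hT.2 h.1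
        exact ⟨T', by simpa using h1, h2⟩
      · intro T _
        exact (prod_extendFilling h.1 T a).symm
    · rw [mul_zero]
      refine Finset.sum_eq_zero fun T hT => ?_
      simp only [Finset.mem_filter, Finset.mem_univ, true_and] at hT
      exact absurd (hT.2 ▸ innerShape_strip hanti hT.1) h
  · intro T hT
    simp only [Finset.mem_filter, Finset.mem_univ, true_and] at hT
    exact (innerShape_strip hanti hT).mem_boxPartitions hlam

lemma schur_zero_variables {l : ℕ} (lam : Fin l → ℕ) (a : Fin 0 → ℂ) :
    schur lam a = if lam = 0 then 1 else 0 := by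
  classical
  unfold schur
  split_ifs with h
  · subst h
    have : IsEmpty (Cell (0 : Fin l → ℕ)) := ⟨fun c => c.2.elim0⟩
    rw [Finset.filter_true_of_mem fun T _ =>
      ⟨fun i j => j.elim0, fun i i' j => j.elim0⟩]
    simp
  · obtain ⟨i, hi⟩ : ∃ i, lam i ≠ 0 := by
      by_contra! h'
      exact h (funext h')
    have : IsEmpty (Cell lam → Fin 0) := ⟨fun T => (T ⟨i, ⟨0, Nat.pos_of_ne_zero hi⟩⟩).elim0⟩
    rw [Finset.univ_eq_empty, Finset.filter_empty, Finset.sum_empty]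

/-- The Jacobi–Trudi formula: the Schur polynomial is the minor of the Toeplitz matrix whose symbol
generates the complete homogeneous symmetric polynomials. -/
theorem schur_eq_minor {l M k : ℕ} {lam : Fin l → ℕ} (hlam : lam ∈ boxPartitions l M)
    (a : Fin k → ℂ) : schur lam a = minor (∏ j, geom (a j)) 0 lam := by
  classical
  induction k generalizing lam with
  | zero =>
    rw [schur_zero_variables, Fin.prod_univ_zero,
      minor_one (nu := 0) antitone_const (mem_boxPartitions.1 hlam).2]
    simp only [eq_comm]
  | succ k ih =>
    rw [schur_succ hlam, Fin.prod_univ_castSucc, minor_mul _ _ _ hlam]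
    refine Finset.sum_congr rfl fun mu hmu => ?_
    rw [ih hmu, minor_geom _ (mem_boxPartitions.1 hmu).2 (mem_boxPartitions.1 hlam).2]

lemma schur_comp_perm {l M k : ℕ} {lam : Fin l → ℕ} (hlam : lam ∈ boxPartitions l M)
    (a : Fin k → ℂ) (σ : Equiv.Perm (Fin k)) : schur lam (a ∘ σ) = schur lam a := by
  rw [schur_eq_minor hlam, schur_eq_minor hlam]
  congr 1
  exact Equiv.prod_comp σ fun j => geom (a j)

/-! ### Character polynomials as Toeplitz minors -/

/-- The power series `∑_{j=1}^r x_j z ^ j`. -/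
def timeSeries (r : ℕ) (x : ℕ → ℂ) : PowerSeries ℂ :=
  ∑ j ∈ Finset.Icc 1 r, PowerSeries.C (x j) * PowerSeries.X ^ j

/-- The generating series `exp (∑_{j=1}^r x_j z ^ j)` of the one row character polynomials. -/
def zetaSeries (r : ℕ) (x : ℕ → ℂ) : PowerSeries ℂ := (PowerSeries.exp ℂ).subst (timeSeries r x)

lemma coeff_timeSeries (r : ℕ) (x : ℕ → ℂ) (k : ℕ) :
    PowerSeries.coeff k (timeSeries r x) = if k ∈ Finset.Icc 1 r then x k else 0 := by
  simp only [timeSeries, map_sum, PowerSeries.coeff_C_mul, PowerSeries.coeff_X_pow, mul_ite,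
    mul_one, mul_zero, Finset.sum_ite_eq]

lemma constantCoeff_timeSeries (r : ℕ) (x : ℕ → ℂ) :
    PowerSeries.constantCoeff (timeSeries r x) = 0 := by
  rw [← PowerSeries.coeff_zero_eq_constantCoeff_apply, coeff_timeSeries]
  simp

lemma hasSubst_timeSeries (r : ℕ) (x : ℕ → ℂ) : PowerSeries.HasSubst (timeSeries r x) :=
  PowerSeries.HasSubst.of_constantCoeff_zero' (constantCoeff_timeSeries r x)

lemma zeta_eq_toeplitz (r : ℕ) (x : ℕ → ℂ) (k l : ℕ) :
    zeta r x ((l : ℤ) - (k : ℤ)) = toeplitz (zetaSeries r x) k l := by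
  unfold zeta toeplitz
  by_cases h : k ≤ l
  · rw [if_pos h, if_pos (by omega), show ((l : ℤ) - (k : ℤ)).toNat = l - k by omega]
    rfl
  · rw [if_neg h, if_neg (by omega)]

lemma character_eq_minor (r : ℕ) {N : ℕ} (lam : Fin N → ℕ) (x : ℕ → ℂ) :
    character r lam x = minor (zetaSeries r x) 0 lam := by
  unfold character minor
  rw [← Matrix.det_transpose, ← Matrix.det_submatrix_equiv_self Fin.revPerm]
  congr 1
  ext i j
  simp only [Matrix.submatrix_apply, Matrix.transpose_apply, Matrix.of_apply, Fin.revPerm_apply]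
  rw [← zeta_eq_toeplitz]
  congr 1
  have := i.2
  have := j.2
  simp only [position, Pi.zero_apply, Fin.val_rev]
  omega

lemma minor_congr {f g : PowerSeries ℂ} {N M : ℕ} (nu : Fin N → ℕ) {lam : Fin N → ℕ}
    (hlam : lam ∈ boxPartitions N M)
    (h : ∀ k < N + M, PowerSeries.coeff k f = PowerSeries.coeff k g) :
    minor f nu lam = minor g nu lam := by
  unfold minor toeplitz
  congr 1
  ext i j
  have := position_lt hlam j
  simp only [Matrix.of_apply]
  split_ifs
  · exact h _ (by omega)
  · rfl

/-- A power series is determined up to order `r` by its constant term and, up to order `r - 1`,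
its logarithmic derivative. -/
lemma coeff_eq_of_logDeriv_eq {F G f g : PowerSeries ℂ} {r : ℕ}
    (hF : PowerSeries.derivative ℂ F = F * f) (hG : PowerSeries.derivative ℂ G = G * g)
    (h0 : PowerSeries.constantCoeff F = PowerSeries.constantCoeff G)
    (hfg : ∀ k < r, PowerSeries.coeff k f = PowerSeries.coeff k g) (k : ℕ) (hk : k ≤ r) :
    PowerSeries.coeff k F = PowerSeries.coeff k G := by
  induction k using Nat.strong_induction_on with
  | _ k ih =>
    cases k with
    | zero => simpa using h0
    | succ k =>
      have h1 := congrArg (PowerSeries.coeff k) hF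
      have h2 := congrArg (PowerSeries.coeff k) hG
      rw [PowerSeries.coeff_derivative, PowerSeries.coeff_mul] at h1 h2
      have h3 : (k : ℂ) + 1 ≠ 0 := Nat.cast_add_one_ne_zero k
      refine mul_right_cancel₀ h3 ?_
      rw [h1, h2]
      refine Finset.sum_congr rfl fun p hp => ?_
      have := Finset.HasAntidiagonal.mem_antidiagonal.1 hp
      rw [ih p.1 (by omega) (by omega), hfg p.2 (by omega)]

lemma derivative_geom (a : ℂ) :
    PowerSeries.derivative ℂ (geom a) = geom a * (PowerSeries.C a * geom a) := by
  have h := congrArg (PowerSeries.derivative ℂ) (geom_mul a)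
  have hC : PowerSeries.derivative ℂ (PowerSeries.C a) = 0 := PowerSeries.derivative_C
  simp only [Derivation.leibniz, map_sub, PowerSeries.derivative_X, hC, smul_eq_mul,
    Derivation.map_one_eq_zero] at h
  have h1 := geom_mul a
  linear_combination (geom a) * h -
    (PowerSeries.derivative ℂ (geom a)) * h1

lemma derivative_prod_geom {N : ℕ} (a : Fin N → ℂ) :
    PowerSeries.derivative ℂ (∏ j, geom (a j)) =
      (∏ j, geom (a j)) * ∑ j, PowerSeries.C (a j) * geom (a j) := by
  induction N with
  | zero => simp
  | succ N ih =>
    rw [Fin.prod_univ_succ, Fin.sum_univ_succ, Derivation.leibniz, ih, derivative_geom]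
    simp only [smul_eq_mul]
    ring

/-- The generating series of the complete homogeneous symmetric polynomials is the exponential
of the generating series of the normalized power sums. -/
lemma coeff_zetaSeries_powerSumTimes {N : ℕ} (r : ℕ) (a : Fin N → ℂ) (k : ℕ) (hk : k ≤ r) :
    PowerSeries.coeff k (zetaSeries r (powerSumTimes a)) =
      PowerSeries.coeff k (∏ j, geom (a j)) := by
  refine coeff_eq_of_logDeriv_eq (f := PowerSeries.derivative ℂ (timeSeries r (powerSumTimes a)))
    ?_ (derivative_prod_geom a) ?_ ?_ k hk
  · unfold zetaSeries
    rw [PowerSeries.derivative_subst (hasSubst_timeSeries _ _), PowerSeries.derivative_exp]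
  · have h1 : PowerSeries.constantCoeff (zetaSeries r (powerSumTimes a)) = 1 := by
      rw [← PowerSeries.coeff_zero_eq_constantCoeff_apply, zetaSeries,
        PowerSeries.coeff_subst' (hasSubst_timeSeries _ _), finsum_eq_single _ 0]
      · simp
      · intro d hd
        simp [constantCoeff_timeSeries, hd]
    rw [h1, map_prod]
    simp [geom, ← PowerSeries.coeff_zero_eq_constantCoeff_apply]
  · intro k hk
    rw [PowerSeries.coeff_derivative, coeff_timeSeries,
      if_pos (Finset.mem_Icc.2 ⟨by omega, by omega⟩), map_sum]
    have h3 : (k : ℂ) + 1 ≠ 0 := Nat.cast_add_one_ne_zero k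
    simp only [powerSumTimes, PowerSeries.coeff_C_mul, geom, PowerSeries.coeff_mk, pow_succ']
    push_cast
    field_simp

/-- Character polynomials restrict to Schur polynomials. -/
theorem character_powerSumTimes {N M : ℕ} {lam : Fin N → ℕ} (hlam : lam ∈ boxPartitions N M)
    {r : ℕ} (hr : N + M ≤ r + 1) (a : Fin N → ℂ) :
    character r lam (powerSumTimes a) = schur lam a := by
  rw [character_eq_minor, schur_eq_minor hlam]
  exact minor_congr 0 hlam fun k hk => coeff_zetaSeries_powerSumTimes r a k (by omega)

/-! ### The `τ`-function as a sum over partitions -/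

/-- A sum over `m, …, n - 1` in terms of the offset from `m`. -/
lemma sum_Ico_eq_sum_range {m n : ℤ} {K : ℕ} (hK : n = m + K) (F : ℤ → ℂ) :
    ∑ t : Finset.Ico m n, F t = ∑ t ∈ Finset.range K, F (m + t) := by
  rw [Finset.sum_coe_sort (Finset.Ico m n) F]
  refine Finset.sum_bij (fun t _ => (t - m).toNat) ?_ ?_ ?_ ?_
  · intro t ht
    simp at ht ⊢; omega
  · intro t ht t' ht' h
    simp at ht ht' h; omega
  · intro t ht
    refine ⟨m + t, ?_, by omega⟩
    simp at ht ⊢; omega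
  · intro t ht
    simp at ht
    congr 1; omega

lemma entry_coe {m n : ℤ} (A : Mat m n) (i j : Finset.Ico m n) : entry A i j = A i j :=
  dif_pos ⟨i.2, j.2⟩

lemma entry_transpose {m n : ℤ} (A : Mat m n) (i j : ℤ) : entry A.transpose i j = entry A j i := by
  unfold entry
  by_cases h : i ∈ Finset.Ico m n ∧ j ∈ Finset.Ico m n
  · rw [dif_pos h, dif_pos h.symm]; rfl
  · rw [dif_neg h, dif_neg fun h' => h h'.symm]

lemma entry_mul {m n : ℤ} {K : ℕ} (hK : n = m + K) (A B : Mat m n) (i j : ℤ) :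
    entry (A * B) i j = ∑ t ∈ Finset.range K, entry A i (m + t) * entry B (m + t) j := by
  rw [← sum_Ico_eq_sum_range hK fun t => entry A i t * entry B t j]
  by_cases h : i ∈ Finset.Ico m n ∧ j ∈ Finset.Ico m n
  · rw [entry, dif_pos h, Matrix.mul_apply]
    refine Finset.sum_congr rfl fun t _ => ?_
    rw [← entry_coe A ⟨i, h.1⟩ t, ← entry_coe B t ⟨j, h.2⟩]
  · rw [entry, dif_neg h]
    symm
    refine Finset.sum_eq_zero fun t _ => ?_
    by_cases hi : i ∈ Finset.Ico m n
    · rw [show entry B t j = 0 from dif_neg fun h' => h ⟨hi, h'.2⟩, mul_zero]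
    · rw [show entry A i t = 0 from dif_neg fun h' => hi h'.1, zero_mul]

/-- The algebra homomorphism which substitutes the shift matrix `Λ` into power series; its values
are the upper triangular Toeplitz matrices. -/
def toeplitzHom (m n : ℤ) : PowerSeries ℂ →ₐ[ℂ] Mat m n :=
  AlgHom.ofLinearMap
    { toFun := fun f => Matrix.of fun k l => toeplitz f ((k : ℤ) - m).toNat ((l : ℤ) - m).toNat
      map_add' := fun f g => by
        ext k l
        simp only [Matrix.of_apply, Matrix.add_apply, toeplitz, map_add]
        split_ifs <;> simp
      map_smul' := fun c f => by
        ext k l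
        simp only [Matrix.of_apply, Matrix.smul_apply, toeplitz, PowerSeries.coeff_smul,
          RingHom.id_apply, smul_eq_mul]
        split_ifs <;> simp }
    (by
      ext k l
      have hk := Finset.mem_Ico.1 k.2
      have hl := Finset.mem_Ico.1 l.2
      simp only [LinearMap.coe_mk, AddHom.coe_mk, Matrix.of_apply, toeplitz,
        PowerSeries.coeff_one, Matrix.one_apply, ← ite_and]
      refine if_congr ?_ rfl rfl
      rw [← Subtype.coe_inj]
      omega)
    (by
      intro f g
      ext k l
      have hl := Finset.mem_Ico.1 l.2
      simp only [LinearMap.coe_mk, AddHom.coe_mk, Matrix.of_apply, Matrix.mul_apply]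
      rw [← sum_toeplitz_mul_toeplitz f g (K := (n - m).toNat) (by omega),
        sum_Ico_eq_sum_range (K := (n - m).toNat) (by omega)
          fun t => toeplitz f ((k : ℤ) - m).toNat (t - m).toNat *
            toeplitz g (t - m).toNat ((l : ℤ) - m).toNat]
      refine Finset.sum_congr rfl fun t _ => ?_
      rw [show (m + (t : ℤ) - m).toNat = t by omega])

lemma toeplitzHom_apply (m n : ℤ) (f : PowerSeries ℂ) (k l : Finset.Ico m n) :
    toeplitzHom m n f k l = toeplitz f ((k : ℤ) - m).toNat ((l : ℤ) - m).toNat := rfl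

lemma entry_toeplitzHom {m n : ℤ} {K : ℕ} (hK : n = m + K) (f : PowerSeries ℂ) {k l : ℕ}
    (hk : k < K) (hl : l < K) : entry (toeplitzHom m n f) (m + k) (m + l) = toeplitz f k l := by
  unfold entry
  rw [dif_pos ⟨Finset.mem_Ico.2 ⟨by omega, by omega⟩, Finset.mem_Ico.2 ⟨by omega, by omega⟩⟩,
    toeplitzHom_apply]
  congr 1 <;> simp

lemma toeplitzHom_X (m n : ℤ) : toeplitzHom m n PowerSeries.X = shift m n := by
  ext k l
  have hk := Finset.mem_Ico.1 k.2
  have hl := Finset.mem_Ico.1 l.2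
  rw [toeplitzHom_apply]
  simp only [toeplitz, PowerSeries.coeff_X, shift, Matrix.of_apply, ← ite_and]
  refine if_congr ?_ rfl rfl
  omega

lemma toeplitzHom_timeSeries (m n : ℤ) (r : ℕ) (x : ℕ → ℂ) :
    toeplitzHom m n (timeSeries r x) = ∑ k ∈ Finset.Icc 1 r, x k • shift m n ^ k := by
  rw [timeSeries, map_sum]
  refine Finset.sum_congr rfl fun k _ => ?_
  rw [← PowerSeries.smul_eq_C_mul, map_smul, map_pow, toeplitzHom_X]

/-- The substitution of `Λ` is compatible with exponentials, which are finite sums since `Λ` is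
nilpotent. -/
lemma exp_toeplitzHom (m n : ℤ) {g : PowerSeries ℂ} (hg : PowerSeries.constantCoeff g = 0) :
    NormedSpace.exp (toeplitzHom m n g) = toeplitzHom m n ((PowerSeries.exp ℂ).subst g) := by
  set K := (n - m).toNat with hKdef
  have hcoeff : ∀ d < K, ∀ k, k ∉ Finset.range K → PowerSeries.coeff d (g ^ k) = 0 := by
    intro d hd k hk
    refine PowerSeries.coeff_of_lt_order _ ?_
    have h1 : ((k : ℕ) : ℕ∞) ≤ (g ^ k).order :=
      PowerSeries.le_order_pow_of_constantCoeff_eq_zero k hg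
    refine lt_of_lt_of_le ?_ h1
    have : d < k := by simp at hk; omega
    exact_mod_cast this
  have hzero : ∀ k, k ∉ Finset.range K → toeplitzHom m n g ^ k = 0 := by
    intro k hk
    rw [← map_pow]
    ext i j
    have hj := Finset.mem_Ico.1 j.2
    rw [toeplitzHom_apply, toeplitz]
    split_ifs
    · rw [hcoeff _ (by omega) k hk]; rfl
    · rfl
  rw [NormedSpace.exp_eq_tsum ℂ]
  simp only
  rw [tsum_eq_sum (s := Finset.range K) fun k hk => by rw [hzero k hk, smul_zero]]
  simp_rw [← map_pow, ← map_smul, ← map_sum]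
  ext i j
  have hj := Finset.mem_Ico.1 j.2
  rw [toeplitzHom_apply, toeplitzHom_apply, toeplitz, toeplitz]
  split_ifs
  · rw [PowerSeries.coeff_subst' (PowerSeries.HasSubst.of_constantCoeff_zero' hg),
      finsum_eq_sum_of_support_subset (s := Finset.range K), map_sum]
    · refine Finset.sum_congr rfl fun k _ => ?_
      rw [PowerSeries.coeff_smul, PowerSeries.coeff_exp]
      simp
    · intro k hk
      by_contra hk'
      refine hk ?_
      change _ • PowerSeries.coeff _ (g ^ k) = 0
      rw [hcoeff _ (by omega) k (by simpa using hk'), smul_zero]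
  · rfl

lemma evolved_eq {m n : ℤ} (A : Mat m n) (x y : ℕ → ℂ) :
    evolved A x y = toeplitzHom m n (zetaSeries (numTimes m n) x) * A *
      (toeplitzHom m n (zetaSeries (numTimes m n) (-y))).transpose := by
  unfold evolved zetaSeries
  rw [← exp_toeplitzHom m n (constantCoeff_timeSeries _ _),
    ← exp_toeplitzHom m n (constantCoeff_timeSeries _ _), toeplitzHom_timeSeries,
    toeplitzHom_timeSeries, ← Matrix.exp_transpose]
  congr 2
  simp [Matrix.transpose_sum, Matrix.transpose_smul, Matrix.transpose_pow]

lemma leadingMinor_eq {m n : ℤ} (A : Mat m n) {s : ℤ} {N : ℕ} (hs : s = m + N) :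
    leadingMinor A s =
      Matrix.det (Matrix.of fun i j : Fin N => entry A (m + (i : ℤ)) (m + (j : ℤ))) := by
  obtain rfl : (s - m).toNat = N := by omega
  rfl

lemma coefficient_eq {m n : ℤ} (A : Mat m n) {N : ℕ} (lam mu : Fin N → ℕ) :
    coefficient A lam mu = Matrix.det (Matrix.of fun i j : Fin N =>
      entry A (m + (position lam i : ℕ)) (m + (position mu j : ℕ))) := by
  unfold coefficient
  congr 1
  ext i j
  simp only [Matrix.of_apply, position]
  congr 1 <;> push_cast <;> ring

/-- The expansion of the `τ`-function of arbitrary initial data, by Cauchy–Binet. -/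
lemma tau_eq_sum_coefficient {N M : ℕ} {m n s : ℤ} (hn : n = m + ((N + M : ℕ) : ℤ))
    (hs : s = m + N) (A : Mat m n) (x y : ℕ → ℂ) :
    tau A s x y = ∑ mu ∈ boxPartitions N M, (∑ lam ∈ boxPartitions N M,
      character (numTimes m n) lam x * coefficient A lam mu) *
        character (numTimes m n) mu (-y) := by
  rw [tau, leadingMinor_eq _ hs, evolved_eq]
  simp_rw [entry_mul hn _ (Matrix.transpose _)]
  rw [det_sum_eq_sum_boxPartitions M
    (fun i t => entry (toeplitzHom m n _ * A) (m + (i : ℤ)) (m + t))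
    fun t j => entry (Matrix.transpose _) (m + (t : ℤ)) (m + (j : ℤ))]
  refine Finset.sum_congr rfl fun mu hmu => ?_
  simp_rw [entry_mul hn _ A]
  rw [det_sum_eq_sum_boxPartitions M (fun i t => entry (toeplitzHom m n _) (m + (i : ℤ)) (m + t))
    fun t j => entry A (m + (t : ℤ)) (m + (position mu j : ℕ))]
  have key : ∀ (f : PowerSeries ℂ), ∀ lam ∈ boxPartitions N M,
      (Matrix.of fun i j : Fin N =>
        entry (toeplitzHom m n f) (m + (i : ℤ)) (m + (position lam j : ℕ))).det =
      minor f 0 lam := by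
    intro f lam hlam
    unfold minor
    congr 1
    ext i j
    rw [Matrix.of_apply, Matrix.of_apply,
      entry_toeplitzHom hn f (i.2.trans_le (Nat.le_add_right _ _)) (position_lt hlam j)]
    simp [position]
  congr 1
  · refine Finset.sum_congr rfl fun lam hlam => ?_
    rw [key _ lam hlam, coefficient_eq, character_eq_minor]
  · rw [← Matrix.det_transpose, character_eq_minor, ← key _ mu hmu]
    congr 1
    ext i j
    simp [entry_transpose]

theorem tau_eq_sum_character {N M : ℕ} {m n s : ℤ} (hn : n = m + ((N + M : ℕ) : ℤ))
    (hs : s = m + N) (A : Mat m n)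
    (hA : ∀ lam ∈ boxPartitions N M, ∀ mu ∈ boxPartitions N M,
      coefficient A lam mu = if lam = mu then 1 else 0) (x y : ℕ → ℂ) :
    tau A s x y = ∑ lam ∈ boxPartitions N M,
      character (numTimes m n) lam x * character (numTimes m n) lam (-y) := by
  rw [tau_eq_sum_coefficient hn hs]
  refine Finset.sum_congr rfl fun mu hmu => ?_
  congr 1
  rw [Finset.sum_eq_single_of_mem mu hmu]
  · rw [hA mu hmu mu hmu, if_pos rfl, mul_one]
  · intro lam hlam hne
    rw [hA lam hlam mu hmu, if_neg hne, mul_zero]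

lemma coefficient_one {N M : ℕ} {m n : ℤ} (hn : n = m + ((N + M : ℕ) : ℤ))
    {lam mu : Fin N → ℕ} (hlam : lam ∈ boxPartitions N M) (hmu : mu ∈ boxPartitions N M) :
    coefficient (1 : Mat m n) lam mu = if lam = mu then 1 else 0 := by
  rw [coefficient_eq, ← minor_one (mem_boxPartitions.1 hlam).2 (mem_boxPartitions.1 hmu).2,
    ← map_one (toeplitzHom m n), minor]
  congr 1
  ext i j
  exact entry_toeplitzHom hn 1 (position_lt hlam i) (position_lt hmu j)

lemma isInitialData_one (m n : ℤ) : IsInitialData (1 : Mat m n) := by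
  refine ⟨isUnit_one, fun s hms hsn => ?_⟩
  have : leadingMinor (1 : Mat m n) s = 1 := by
    rw [leadingMinor, ← Matrix.det_one (n := Fin (s - m).toNat)]
    congr 1
    ext i j
    rw [Matrix.of_apply, entry, dif_pos, Matrix.one_apply, Matrix.one_apply]
    · refine if_congr ?_ rfl rfl
      rw [Subtype.mk_eq_mk, Fin.ext_iff]
      omega
    · have := i.2
      have := j.2
      exact ⟨Finset.mem_Ico.2 (by omega), Finset.mem_Ico.2 (by omega)⟩
  rw [this]
  exact one_ne_zero

end Toda

namespace PhaseModel

/-! ### Matrix elements of the monodromy matrix -/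

/-- An entry of an ordered product of `2 × 2` matrices as a sum over paths. -/
lemma prod_reverse_ofFn_apply {R : Type*} [Semiring R] {K : ℕ}
    (L : Fin K → Matrix (Fin 2) (Fin 2) R) (a b : Fin 2) :
    (List.ofFn L).reverse.prod a b = ∑ e : Fin (K + 1) → Fin 2,
      if e 0 = b ∧ e (Fin.last K) = a then
        (List.ofFn fun j => L j (e j.succ) (e j.castSucc)).reverse.prod else 0 := by
  induction K generalizing a with
  | zero =>
    rw [← (Equiv.funUnique (Fin 1) (Fin 2)).symm.sum_comp]
    simp [Matrix.one_apply, ite_and, eq_comm]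
  | succ K ih =>
    rw [← (Fin.snocEquiv fun _ => Fin 2).sum_comp, Fintype.sum_prod_type, List.ofFn_succ',
      List.concat_eq_append, List.reverse_append, List.reverse_singleton, List.singleton_append,
      List.prod_cons, Matrix.mul_apply]
    have h0 : ∀ (p : Fin 2) (e : Fin (K + 1) → Fin 2),
        (Fin.snoc e p : Fin (K + 2) → Fin 2) 0 = e 0 := fun p e => by
      rw [← Fin.castSucc_zero, Fin.snoc_castSucc]
    have h1 : ∀ (p : Fin 2) (e : Fin (K + 1) → Fin 2),
        (List.ofFn fun j => L j ((Fin.snoc e p : Fin (K + 2) → Fin 2) j.succ)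
          ((Fin.snoc e p : Fin (K + 2) → Fin 2) j.castSucc)).reverse.prod =
        L (Fin.last K) p (e (Fin.last K)) *
          (List.ofFn fun j : Fin K => L j.castSucc (e j.succ) (e j.castSucc)).reverse.prod := by
      intro p e
      rw [List.ofFn_succ', List.concat_eq_append, List.reverse_append, List.reverse_singleton,
        List.singleton_append, List.prod_cons]
      simp only [Fin.snoc_castSucc, Fin.succ_last, Fin.snoc_last, Fin.succ_castSucc]
    simp only [Fin.snocEquiv_apply, h0, h1, Fin.snoc_last]
    rw [Finset.sum_eq_single_of_mem a (Finset.mem_univ a)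
      (f := fun p => ∑ e : Fin (K + 1) → Fin 2, if e 0 = b ∧ p = a then
        L (Fin.last K) p (e (Fin.last K)) *
          (List.ofFn fun j : Fin K => L j.castSucc (e j.succ) (e j.castSucc)).reverse.prod else 0)
      (fun p _ hp => Finset.sum_eq_zero fun e _ => if_neg fun h => hp h.2)]
    simp_rw [ih, Finset.mul_sum]
    rw [Finset.sum_comm]
    refine Finset.sum_congr rfl fun e _ => ?_
    rw [Finset.sum_eq_single_of_mem (e (Fin.last K)) (Finset.mem_univ _)
      (fun c _ hc => by rw [if_neg fun h => hc h.2.symm, mul_zero])]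
    simp

lemma atSite_tprod (M : ℕ) (j : Fin (M + 1)) (T : Module.End ℂ Site) (x : Fin (M + 1) → Site) :
    atSite M j T (PiTensorProduct.tprod ℂ x) =
      PiTensorProduct.tprod ℂ (Function.update x j (T (x j))) := by
  rw [atSite, PiTensorProduct.map_tprod]
  congr 1
  funext i
  by_cases h : i = j
  · subst h; simp
  · simp [h]

lemma prod_atSite_tprod (M : ℕ) (T : Fin (M + 1) → Module.End ℂ Site) (x : Fin (M + 1) → Site)
    {l : List (Fin (M + 1))} (hl : l.Nodup) :
    (l.map fun j => atSite M j (T j)).prod (PiTensorProduct.tprod ℂ x) =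
      PiTensorProduct.tprod ℂ fun j => if j ∈ l then T j (x j) else x j := by
  induction l with
  | nil => simp
  | cons i l ih =>
    rw [List.nodup_cons] at hl
    rw [List.map_cons, List.prod_cons, Module.End.mul_apply, ih hl.2, atSite_tprod]
    congr 1
    funext j
    by_cases h : j = i
    · subst h; simp [hl.1]
    · simp [h]

lemma atSite_smul_one (M : ℕ) (j : Fin (M + 1)) (c : ℂ) :
    atSite M j (c • (1 : Module.End ℂ Site)) = c • (1 : Module.End ℂ (Fock M)) := by
  refine PiTensorProduct.ext (MultilinearMap.ext fun x => ?_)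
  simp [atSite_tprod]

/-- The local operator matrix `L(u)` on the one-site Fock space. -/
def siteOperator (u : ℂ) : Matrix (Fin 2) (Fin 2) (Module.End ℂ Site) :=
  !![u⁻¹ • (1 : Module.End ℂ Site), phiDag; phi, u • (1 : Module.End ℂ Site)]

lemma lOperator_apply (M : ℕ) (j : Fin (M + 1)) (u : ℂ) (a b : Fin 2) :
    lOperator M j u a b = atSite M j (siteOperator u a b) := by
  fin_cases a <;> fin_cases b <;> simp [lOperator, siteOperator, atSite_smul_one]

/-- The action of the monodromy matrix on a pure tensor, as a sum over paths: `e j` is the state of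
the auxiliary two-dimensional space before it meets the site `j`. -/
lemma monodromy_tprod (M : ℕ) (u : ℂ) (a b : Fin 2) (x : Fin (M + 1) → Site) :
    monodromy M u a b (PiTensorProduct.tprod ℂ x) = ∑ e : Fin (M + 2) → Fin 2,
      if e 0 = b ∧ e (Fin.last (M + 1)) = a then
        PiTensorProduct.tprod ℂ fun j => siteOperator u (e j.succ) (e j.castSucc) (x j) else 0 := by
  refine (LinearMap.congr_fun (prod_reverse_ofFn_apply (fun j => lOperator M j u) a b) _).trans ?_
  rw [LinearMap.sum_apply]
  refine Finset.sum_congr rfl fun e _ => ?_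
  split_ifs
  · simp_rw [lOperator_apply]
    rw [List.ofFn_eq_map, ← List.map_reverse,
      prod_atSite_tprod M (fun j => siteOperator u (e j.succ) (e j.castSucc)) x
        (List.nodup_reverse.2 (List.nodup_finRange _))]
    simp
  · rfl

lemma phi_ket (k : ℕ) : phi (ket k) = if k = 0 then 0 else ket (k - 1) := by
  simp [phi, ket]

lemma phiDag_ket (k : ℕ) : phiDag (ket k) = ket (k + 1) := by
  simp [phiDag, ket]

/-- Particle number conservation at one site: `L_{ab}` changes the occupation number by `b - a`. -/
lemma siteOperator_ket (u : ℂ) (a b : Fin 2) (k : ℕ) :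
    siteOperator u a b (ket k) =
      if (a : ℕ) ≤ k + b then u ^ ((a : ℤ) + (b : ℤ) - 1) • ket (k + b - a) else 0 := by
  fin_cases a <;> fin_cases b <;> simp [siteOperator, phi_ket, phiDag_ket]
  by_cases h : k = 0
  · simp [h]
  · simp [h, Nat.one_le_iff_ne_zero]

/-! ### Transposition -/

/-- The basis of the Fock space consisting of the vectors `|n_0⟩ ⊗ ⋯ ⊗ |n_M⟩`. -/
def fockBasis (M : ℕ) : Module.Basis (Fin (M + 1) → ℕ) ℂ (Fock M) :=
  Basis.piTensorProduct fun _ => Finsupp.basisSingleOne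

lemma fockBasis_apply (M : ℕ) (n : Fin (M + 1) → ℕ) :
    fockBasis M n = PiTensorProduct.tprod ℂ fun j => ket (n j) := by
  simp [fockBasis, Basis.piTensorProduct_apply, ket]

lemma fockBasis_repr_tprod (M : ℕ) (x : Fin (M + 1) → Site) (n : Fin (M + 1) → ℕ) :
    (fockBasis M).repr (PiTensorProduct.tprod ℂ x) n = ∏ j, x j (n j) := by
  simp [fockBasis, Basis.piTensorProduct_repr_tprod_apply]

lemma siteOperator_transpose (v : ℂ) (a b : Fin 2) (k l : ℕ) :
    siteOperator v⁻¹ a b (ket k) l = siteOperator v a.rev b.rev (ket l) k := by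
  rw [siteOperator_ket, siteOperator_ket]
  fin_cases a <;> fin_cases b <;> simp [ket, Finsupp.single_apply]
  · simp only [eq_comm]
  · split_ifs <;> grind
  · split_ifs <;> grind
  · simp only [eq_comm]

/-- With respect to the standard bilinear form on the Fock space, `C(v)` is the transpose of
`B(v⁻¹)`. -/
lemma toDual_opB (M : ℕ) (v : ℂ) (x y : Fock M) :
    (fockBasis M).toDual (opB M v⁻¹ x) y = (fockBasis M).toDual x (opC M v y) := by
  suffices h : (fockBasis M).toDual ∘ₗ opB M v⁻¹ =
      ((fockBasis M).toDual.flip ∘ₗ opC M v).flip by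
    exact LinearMap.congr_fun (LinearMap.congr_fun h x) y
  refine (fockBasis M).ext fun n => (fockBasis M).ext fun n' => ?_
  simp only [LinearMap.comp_apply, LinearMap.flip_apply]
  rw [Module.Basis.toDual_apply_left, Module.Basis.toDual_apply_right, fockBasis_apply,
    fockBasis_apply, opB, opC, monodromy_tprod, monodromy_tprod, map_sum, map_sum,
    Finset.sum_apply', Finset.sum_apply',
    ← (Equiv.piCongrRight fun _ : Fin (M + 2) => (Fin.revPerm : Equiv.Perm (Fin 2))).sum_comp]
  refine Finset.sum_congr rfl fun e _ => ?_
  have h : ((Equiv.piCongrRight fun _ : Fin (M + 2) => (Fin.revPerm : Equiv.Perm (Fin 2))) e) =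
    fun j => (e j).rev := rfl
  rw [h]
  by_cases he : e 0 = 0 ∧ e (Fin.last (M + 1)) = 1
  · rw [if_pos he, if_pos (by simp [he]), fockBasis_repr_tprod, fockBasis_repr_tprod]
    refine Finset.prod_congr rfl fun j _ => ?_
    rw [siteOperator_transpose, Fin.rev_rev, Fin.rev_rev]
  · rw [if_neg he, if_neg fun h' => he (by simpa [Fin.rev_eq_iff] using h')]
    simp

lemma vacuumBra_eq (M : ℕ) : vacuumBra M = (fockBasis M).toDual (vacuum M) := by
  have hv : vacuum M = fockBasis M 0 := by rw [fockBasis_apply]; rfl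
  refine PiTensorProduct.ext (MultilinearMap.ext fun x => ?_)
  simp only [LinearMap.compMultilinearMap_apply]
  rw [hv, Module.Basis.toDual_apply_right, fockBasis_repr_tprod, vacuumBra,
    PiTensorProduct.lift.tprod]
  simp

lemma toDual_prod_opB (M : ℕ) (l : List ℂ) (x y : Fock M) :
    (fockBasis M).toDual ((l.map fun v => opB M v⁻¹).prod x) y =
      (fockBasis M).toDual x ((l.map fun v => opC M v).reverse.prod y) := by
  induction l generalizing y with
  | nil => rfl
  | cons v l ih =>
    rw [List.map_cons, List.prod_cons, Module.End.mul_apply, toDual_opB, ih, List.map_cons,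
      List.reverse_cons, List.prod_append, List.prod_singleton, Module.End.mul_apply]

/-- The scalar product is the value of the standard bilinear form on two `N`-particle states. -/
lemma scalarProduct_eq_toDual (N M : ℕ) (u v : Fin N → ℂ) :
    scalarProduct N M u v =
      (fockBasis M).toDual (stateKet M fun j => (v j)⁻¹) (stateKet M u) := by
  have h := toDual_prod_opB M (List.ofFn v) (vacuum M) (stateKet M u)
  rw [List.map_ofFn, List.map_ofFn] at h
  rw [scalarProduct, stateBra, LinearMap.comp_apply, vacuumBra_eq]
  exact h.symm

end PhaseModel

namespace Toda

/-! ### Column lengths and horizontal strips -/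

/-- The number of parts of `λ` which are at least `j`: for `j ≥ 1` the length of the `j`-th column
of the Young diagram. -/
def column {N : ℕ} (lam : Fin N → ℕ) (j : ℕ) : ℕ := (Finset.univ.filter fun i => j ≤ lam i).card

lemma lt_column_iff {N : ℕ} {lam : Fin N → ℕ} (h : Antitone lam) (i : Fin N) (j : ℕ) :
    (i : ℕ) < column lam j ↔ j ≤ lam i :=
  lt_card_filter_iff (fun i => j ≤ lam i) (fun _ _ hij hj => hj.trans (h hij)) i

lemma column_le {N : ℕ} (lam : Fin N → ℕ) (j : ℕ) : column lam j ≤ N :=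
  (Finset.card_filter_le _ _).trans (by simp)

lemma column_antitone {N : ℕ} (lam : Fin N → ℕ) : Antitone (column lam) := fun _ _ h =>
  Finset.card_le_card fun _ hi => by
    simp only [Finset.mem_filter, Finset.mem_univ, true_and] at hi ⊢
    exact h.trans hi

lemma column_eq_zero {N M : ℕ} {lam : Fin N → ℕ} (h : lam ∈ boxPartitions N M) {j : ℕ}
    (hj : M < j) : column lam j = 0 := by
  rw [column, Finset.card_eq_zero, Finset.filter_eq_empty_iff]
  intro i _
  have := (mem_boxPartitions.1 h).1 i
  omega

lemma sum_column {N M : ℕ} {lam : Fin N → ℕ} (h : lam ∈ boxPartitions N M) :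
    ∑ j ∈ Finset.range M, column lam (j + 1) = ∑ i, lam i := by
  simp_rw [column, Finset.card_filter]
  rw [Finset.sum_comm]
  refine Finset.sum_congr rfl fun i _ => ?_
  have hi := (mem_boxPartitions.1 h).1 i
  rw [← Finset.card_filter]
  have : (Finset.range M).filter (fun j => j + 1 ≤ lam i) = Finset.range (lam i) := by
    ext j
    simp only [Finset.mem_filter, Finset.mem_range]
    omega
  rw [this, Finset.card_range]

lemma eq_of_column_eq {N M : ℕ} {lam mu : Fin N → ℕ} (hlam : lam ∈ boxPartitions N M)
    (hmu : mu ∈ boxPartitions N M)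
    (h : ∀ j, 1 ≤ j → j ≤ M → column lam j = column mu j) : lam = mu := by
  obtain ⟨hl, hl'⟩ := mem_boxPartitions.1 hlam
  obtain ⟨hm, hm'⟩ := mem_boxPartitions.1 hmu
  funext i
  refine le_antisymm ?_ ?_
  · rcases Nat.eq_zero_or_pos (lam i) with h0 | h0
    · omega
    · rw [← lt_column_iff hm', ← h _ h0 (hl i), lt_column_iff hl']
  · rcases Nat.eq_zero_or_pos (mu i) with h0 | h0
    · omega
    · rw [← lt_column_iff hl', h _ h0 (hm i), lt_column_iff hm']

/-- Conjugation of partitions: the column lengths can be prescribed. -/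
lemma exists_column_eq {N M : ℕ} (c : Fin M → ℕ) (hc : Antitone c) (hN : ∀ j, c j ≤ N) :
    ∃ lam ∈ boxPartitions N M, ∀ j : Fin M, column lam (j + 1) = c j := by
  have key : ∀ (i : ℕ) (j : Fin M),
      (j : ℕ) < (Finset.univ.filter fun j => i < c j).card ↔ i < c j := fun i j =>
    lt_card_filter_iff (fun j => i < c j) (fun _ _ hij hj => hj.trans_le (hc hij)) j
  refine ⟨fun i => (Finset.univ.filter fun j => (i : ℕ) < c j).card,
    mem_boxPartitions.2 ⟨fun i => (Finset.card_filter_le _ _).trans (by simp), ?_⟩, fun j => ?_⟩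
  · intro i i' hii'
    refine Finset.card_le_card fun j hj => ?_
    simp only [Finset.mem_filter, Finset.mem_univ, true_and] at hj ⊢
    exact lt_of_le_of_lt hii' hj
  · simp_rw [column, Nat.succ_le_iff, key]
    exact card_filter_val_lt (hN j)

/-- In terms of columns, a horizontal strip adds at most one cell to each column. -/
lemma isHorizontalStrip_iff_column {N M : ℕ} {mu lam : Fin N → ℕ}
    (hmu : mu ∈ boxPartitions N M) (hlam : lam ∈ boxPartitions N M) :
    IsHorizontalStrip mu lam ↔
      ∀ j, 1 ≤ j → column mu j ≤ column lam j ∧ column lam j ≤ column mu j + 1 := by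
  obtain ⟨hl, hl'⟩ := mem_boxPartitions.1 hlam
  obtain ⟨hm, hm'⟩ := mem_boxPartitions.1 hmu
  constructor
  · rintro ⟨h1, h2⟩ j hj
    refine ⟨Finset.card_le_card fun i hi => ?_, ?_⟩
    · simp only [Finset.mem_filter, Finset.mem_univ, true_and] at hi ⊢
      exact hi.trans (h1 i)
    · by_contra! hlt
      have hN := column_le lam j
      have h3 := (lt_column_iff hl' ⟨column mu j + 1, by omega⟩ j).1 hlt
      have h4 := h2 ⟨column mu j, by omega⟩ ⟨column mu j + 1, by omega⟩ (by simp [Fin.lt_def])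
      exact lt_irrefl _ ((lt_column_iff hm' ⟨column mu j, by omega⟩ j).2 (h3.trans h4))
  · intro h
    refine ⟨fun i => ?_, fun i i' hii' => ?_⟩
    · rcases Nat.eq_zero_or_pos (mu i) with h0 | h0
      · omega
      · rw [← lt_column_iff hl']
        exact ((lt_column_iff hm' i _).2 le_rfl).trans_le (h _ h0).1
    · rcases Nat.eq_zero_or_pos (lam i') with h0 | h0
      · omega
      · rw [← lt_column_iff hm']
        have h1 := (lt_column_iff hl' i' _).2 le_rfl
        have h2 := (h _ h0).2
        have : (i : ℕ) < i' := hii'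
        omega

/-- A Schur polynomial vanishes if there are fewer variables than parts. -/
lemma minor_prod_geom_eq_zero {N M k : ℕ} {lam : Fin N → ℕ} (hlam : lam ∈ boxPartitions N M)
    (a : Fin k → ℂ) (h : k < column lam 1) : minor (∏ j, geom (a j)) 0 lam = 0 := by
  induction k generalizing lam with
  | zero =>
    rw [Fin.prod_univ_zero, minor_one (nu := 0) antitone_const (mem_boxPartitions.1 hlam).2, if_neg]
    rintro rfl
    simp [column] at h
  | succ k ih =>
    rw [Fin.prod_univ_castSucc, minor_mul _ _ _ hlam]
    refine Finset.sum_eq_zero fun mu hmu => ?_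
    rw [minor_geom _ (mem_boxPartitions.1 hmu).2 (mem_boxPartitions.1 hlam).2]
    split_ifs with hs
    · have := (isHorizontalStrip_iff_column hmu hlam).1 hs 1 le_rfl
      rw [ih hmu _ (by omega), zero_mul]
    · rw [mul_zero]

end Toda

namespace PhaseModel

open Toda

/-! ### The state vectors -/

/-- The number of particles at the sites `≥ j` in the state with `k` particles labelled by `λ`: for
`j ≥ 1` it is the length of the `j`-th column. -/
def heights {N : ℕ} (k : ℕ) (lam : Fin N → ℕ) (j : ℕ) : ℕ := if j = 0 then k else column lam j

/-- The occupation numbers of the state with `k` particles labelled by `λ`: the nonzero parts of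
`λ` are the positions of the particles, and the remaining particles are at the site `0`. -/
def occupation {N : ℕ} (M k : ℕ) (lam : Fin N → ℕ) (j : Fin (M + 1)) : ℕ :=
  heights k lam j - heights k lam (j + 1)

lemma heights_zero {N : ℕ} (k : ℕ) (lam : Fin N → ℕ) : heights k lam 0 = k := rfl

lemma heights_of_pos {N : ℕ} (k : ℕ) (lam : Fin N → ℕ) {j : ℕ} (hj : 1 ≤ j) :
    heights k lam j = column lam j := if_neg (by omega)

lemma heights_succ_le {N : ℕ} {k : ℕ} {lam : Fin N → ℕ} (h : column lam 1 ≤ k) (j : ℕ) :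
    heights k lam (j + 1) ≤ heights k lam j := by
  rw [heights_of_pos _ _ (by omega)]
  rcases Nat.eq_zero_or_pos j with rfl | hj
  · exact h
  · rw [heights_of_pos _ _ hj]
    exact column_antitone lam (by omega)

lemma occupation_injective {N M : ℕ} {lam mu : Fin N → ℕ} (hlam : lam ∈ boxPartitions N M)
    (hmu : mu ∈ boxPartitions N M) (h : occupation M N lam = occupation M N mu) : lam = mu := by
  have key : ∀ j, j ≤ M → heights N lam j = heights N mu j := by
    intro j
    induction j with
    | zero => intro _; rfl
    | succ j ih =>
      intro hj
      have h1 := congrFun h ⟨j, by omega⟩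
      have h2 := ih (by omega)
      have h3 := heights_succ_le (column_le lam 1) j
      have h4 := heights_succ_le (column_le mu 1) j
      simp only [occupation] at h1
      omega
  refine eq_of_column_eq hlam hmu fun j h1 hj => ?_
  rw [← heights_of_pos N lam h1, ← heights_of_pos N mu h1, key j hj]

/-- A path through the sites which increases the heights of `μ` to those of `λ`. -/
def pathOf {N : ℕ} (M k : ℕ) (mu lam : Fin N → ℕ) (j : Fin (M + 2)) : Fin 2 :=
  if heights k mu j < heights (k + 1) lam j then 1 else 0

lemma heights_eq_add_pathOf {N M k : ℕ} {mu lam : Fin N → ℕ} (hmu : mu ∈ boxPartitions N M)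
    (hlam : lam ∈ boxPartitions N M) (h : IsHorizontalStrip mu lam) (j : Fin (M + 2)) :
    heights (k + 1) lam j = heights k mu j + pathOf M k mu lam j := by
  have h1 : heights k mu j ≤ heights (k + 1) lam j ∧
      heights (k + 1) lam j ≤ heights k mu j + 1 := by
    rcases Nat.eq_zero_or_pos (j : ℕ) with h0 | h0
    · rw [h0, heights_zero, heights_zero]; omega
    · rw [heights_of_pos _ _ h0, heights_of_pos _ _ h0]
      exact (isHorizontalStrip_iff_column hmu hlam).1 h j h0
  unfold pathOf
  split_ifs
  · rw [Fin.val_one]; omega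
  · rw [Fin.val_zero]; omega

lemma prod_zpow_eq_zpow_sum {ι : Type*} {u : ℂ} (hu : u ≠ 0) (t : Finset ι) (f : ι → ℤ) :
    ∏ j ∈ t, u ^ f j = u ^ ∑ j ∈ t, f j := by
  classical
  induction t using Finset.induction_on with
  | empty => simp
  | insert j t hj ih => rw [Finset.prod_insert hj, Finset.sum_insert hj, zpow_add₀ hu, ih]

lemma tprod_siteOperator_ket {M : ℕ} {u : ℂ} (hu : u ≠ 0) (e : Fin (M + 2) → Fin 2)
    (n : Fin (M + 1) → ℕ) :
    (PiTensorProduct.tprod ℂ fun j => siteOperator u (e j.succ) (e j.castSucc) (ket (n j))) =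
      if ∀ j : Fin (M + 1), (e j.succ : ℕ) ≤ n j + e j.castSucc then
        u ^ (∑ j : Fin (M + 1), ((e j.succ : ℤ) + (e j.castSucc : ℤ) - 1)) •
          fockBasis M (fun j => n j + e j.castSucc - e j.succ)
      else 0 := by
  simp_rw [siteOperator_ket]
  split_ifs with h
  · simp_rw [if_pos (h _)]
    rw [MultilinearMap.map_smul_univ, fockBasis_apply]
    congr 1
    exact prod_zpow_eq_zpow_sum hu _ _
  · push Not at h
    obtain ⟨j, hj⟩ := h
    exact MultilinearMap.map_coord_zero _ j (if_neg (not_le.2 hj))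

open Classical in
/-- The action of `B(u)` on a basis vector: the sum over the horizontal strips. -/
theorem opB_fockBasis {N M k : ℕ} (hk : k < N) {u : ℂ} (hu : u ≠ 0) {mu : Fin N → ℕ}
    (hmu : mu ∈ boxPartitions N M) (hmuk : column mu 1 ≤ k) :
    opB M u (fockBasis M (occupation M k mu)) =
      ∑ lam ∈ boxPartitions N M, if IsHorizontalStrip mu lam then
        (u ^ (-(M : ℤ)) * (u ^ 2) ^ ∑ i, (lam i - mu i)) • fockBasis M (occupation M (k + 1) lam)
      else 0 := by
  rw [opB, fockBasis_apply, monodromy_tprod]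
  simp_rw [tprod_siteOperator_ket hu]
  rw [← Finset.sum_filter, ← Finset.sum_filter, ← Finset.sum_filter, Finset.filter_filter]
  symm
  have hocc : ∀ j : Fin (M + 1), occupation M k mu j + heights k mu (j + 1) = heights k mu j := by
    intro j
    have := heights_succ_le hmuk j
    unfold occupation
    omega
  refine Finset.sum_bij (fun lam _ => pathOf M k mu lam) ?_ ?_ ?_ ?_
  · intro lam hlam
    obtain ⟨hlam, hs⟩ := Finset.mem_filter.1 hlam
    have h1 := heights_eq_add_pathOf (k := k) hmu hlam hs
    have hcol := (isHorizontalStrip_iff_column hmu hlam).1 hs 1 le_rfl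
    have hlamk : column lam 1 ≤ k + 1 := by omega
    refine Finset.mem_filter.2 ⟨Finset.mem_univ _, ⟨?_, ?_⟩, fun j => ?_⟩
    · simp [pathOf, heights_zero]
    · refine if_neg ?_
      rw [Fin.val_last, heights_of_pos _ _ (by omega), heights_of_pos _ _ (by omega),
        column_eq_zero hlam (by omega)]
      omega
    · have h2 := h1 j.succ
      have h3 := h1 j.castSucc
      have h4 := hocc j
      have h5 := heights_succ_le hlamk j
      simp only [Fin.val_succ, Fin.val_castSucc] at h2 h3
      omega
  · intro lam hlam nu hnu h
    obtain ⟨hlam, hs⟩ := Finset.mem_filter.1 hlam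
    obtain ⟨hnu, hs'⟩ := Finset.mem_filter.1 hnu
    refine eq_of_column_eq hlam hnu fun j h1 hj => ?_
    have h2 := heights_eq_add_pathOf (k := k) hmu hlam hs ⟨j, by omega⟩
    have h3 := heights_eq_add_pathOf (k := k) hmu hnu hs' ⟨j, by omega⟩
    have h4 := congrFun h ⟨j, by omega⟩
    simp only at h2 h3 h4
    rw [← heights_of_pos (k + 1) lam h1, ← heights_of_pos (k + 1) nu h1, h2, h3, h4]
  · intro e he
    obtain ⟨-, ⟨he0, he1⟩, hv⟩ := Finset.mem_filter.1 he
    -- the new heights, which are weakly decreasing since the path is admissible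
    let c : Fin (M + 2) → ℕ := fun j => heights k mu j + e j
    have hc : Antitone c := Fin.antitone_iff_succ_le.2 fun j => by
      have h1 := hv j
      have h2 := hocc j
      simp only [c, Fin.val_succ, Fin.val_castSucc]
      omega
    have hc0 : c 0 = k + 1 := by simp [c, he0, heights_zero]
    obtain ⟨lam, hlam, hcol⟩ := exists_column_eq (N := N) (fun j : Fin M => c j.succ.castSucc)
      (fun i j hij => hc (by simpa using hij))
      (fun j => (hc (Fin.zero_le _)).trans (by omega))
    have hh : ∀ j : Fin (M + 2), heights (k + 1) lam j = heights k mu j + e j := by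
      intro j
      refine Fin.cases hc0.symm (fun j => ?_) j
      refine Fin.lastCases ?_ (fun j => ?_) j
      · rw [heights_of_pos _ _ (by simp), heights_of_pos _ _ (by simp),
          column_eq_zero hlam (by simp), column_eq_zero hmu (by simp), Fin.succ_last, he1]
        rfl
      · rw [heights_of_pos _ _ (by simp)]
        exact hcol j
    have hs : IsHorizontalStrip mu lam := by
      refine (isHorizontalStrip_iff_column hmu hlam).2 fun j h1 => ?_
      by_cases hj : j ≤ M
      · have h2 := hh ⟨j, by omega⟩
        have h3 := (e ⟨j, by omega⟩).2
        simp only [heights_of_pos _ _ h1] at h2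
        omega
      · rw [column_eq_zero hlam (by omega), column_eq_zero hmu (by omega)]
        omega
    refine ⟨lam, Finset.mem_filter.2 ⟨hlam, hs⟩, funext fun j => Fin.ext ?_⟩
    have h1 := heights_eq_add_pathOf (k := k) hmu hlam hs j
    have h2 := hh j
    omega
  · intro lam hlam
    obtain ⟨hlam, hs⟩ := Finset.mem_filter.1 hlam
    have h1 := heights_eq_add_pathOf (k := k) hmu hlam hs
    congr 1
    · rw [← pow_mul, ← zpow_natCast, ← zpow_add₀ hu]
      congr 1
      have h2 : ∀ j : Fin (M + 2), ((pathOf M k mu lam j : ℕ) : ℤ) =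
          (heights (k + 1) lam j : ℤ) - heights k mu j := fun j => by rw [h1 j]; push_cast; ring
      have h3 : ∀ (r : ℕ) (nu : Fin N → ℕ), nu ∈ boxPartitions N M →
          ∑ j ∈ Finset.range (M + 1), (heights r nu (j + 1) : ℤ) = ∑ i, (nu i : ℤ) := by
        intro r nu hnu
        rw [Finset.sum_range_succ, heights_of_pos _ _ (by omega), column_eq_zero hnu (by omega)]
        have := sum_column hnu
        zify at this
        rw [← this]
        simp [heights_of_pos]
      have h4 : ∀ (r : ℕ) (nu : Fin N → ℕ), nu ∈ boxPartitions N M →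
          ∑ j ∈ Finset.range (M + 1), (heights r nu j : ℤ) = (∑ i, (nu i : ℤ)) + r := by
        intro r nu hnu
        rw [← h3 r nu hnu, Finset.sum_range_succ', Finset.sum_range_succ,
          heights_of_pos (j := M + 1) _ _ (by omega), column_eq_zero hnu (by omega), heights_zero]
        simp
      have h5 : ((∑ i, (lam i - mu i) : ℕ) : ℤ) = (∑ i, (lam i : ℤ)) - ∑ i, (mu i : ℤ) := by
        rw [← Finset.sum_sub_distrib, Nat.cast_sum]
        exact Finset.sum_congr rfl fun i _ => Nat.cast_sub (hs.1 i)
      simp_rw [h2, Fin.val_succ, Fin.val_castSucc]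
      rw [Fin.sum_univ_eq_sum_range (fun j => ((heights (k + 1) lam (j + 1) : ℤ) -
        heights k mu (j + 1)) + ((heights (k + 1) lam j : ℤ) - heights k mu j) - 1)]
      rw [Finset.sum_sub_distrib, Finset.sum_add_distrib, Finset.sum_sub_distrib,
        Finset.sum_sub_distrib, h3 _ _ hlam, h3 _ _ hmu, h4 _ _ hlam, h4 _ _ hmu]
      push_cast [h5]
      simp
      ring
    · congr 1
      funext j
      have h2 := h1 j.succ
      have h3 := h1 j.castSucc
      have h4 := hocc j
      simp only [Fin.val_succ, Fin.val_castSucc] at h2 h3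
      simp only [occupation] at h4 ⊢
      omega

/-- The expansion of the `k`-particle state in Schur polynomials of the squared parameters. -/
theorem stateKet_eq_sum {N M k : ℕ} (hk : k ≤ N) (u : Fin k → ℂ) (hu : ∀ j, u j ≠ 0) :
    stateKet M u = ∑ lam ∈ boxPartitions N M,
      ((∏ j, u j) ^ (-(M : ℤ)) * minor (∏ j, geom (u j ^ 2)) 0 lam) •
        fockBasis M (occupation M k lam) := by
  classical
  induction k with
  | zero =>
    have h0 : (0 : Fin N → ℕ) ∈ boxPartitions N M :=
      mem_boxPartitions.2 ⟨fun _ => Nat.zero_le _, antitone_const⟩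
    rw [Finset.sum_eq_single_of_mem 0 h0]
    · rw [Fin.prod_univ_zero, Fin.prod_univ_zero,
        minor_one (nu := 0) (lam := 0) antitone_const antitone_const,
        if_pos rfl, one_zpow, one_mul, one_smul, fockBasis_apply]
      have : occupation M 0 (0 : Fin N → ℕ) = 0 := by
        funext j
        by_cases hj : (j : ℕ) = 0 <;> simp [occupation, heights, column, hj]
      rw [this]
      rfl
    · intro lam hlam hne
      rw [Fin.prod_univ_zero (M := PowerSeries ℂ),
        minor_one (nu := 0) antitone_const (mem_boxPartitions.1 hlam).2,
        if_neg (Ne.symm hne), mul_zero, zero_smul]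
  | succ k ih =>
    have h1 : stateKet M u = opB M (u 0) (stateKet M fun j => u j.succ) := by
      rw [stateKet, List.ofFn_succ, List.prod_cons]; rfl
    rw [h1, ih (by omega) _ fun j => hu _, map_sum]
    have h2 : ∀ mu ∈ boxPartitions N M,
        opB M (u 0) (((∏ j : Fin k, u j.succ) ^ (-(M : ℤ)) *
          minor (∏ j : Fin k, geom (u j.succ ^ 2)) 0 mu) • fockBasis M (occupation M k mu)) =
        ∑ lam ∈ boxPartitions N M, ((∏ j, u j) ^ (-(M : ℤ)) *
          (minor (∏ j : Fin k, geom (u j.succ ^ 2)) 0 mu * minor (geom (u 0 ^ 2)) mu lam)) •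
            fockBasis M (occupation M (k + 1) lam) := by
      intro mu hmu
      -- if `μ` has more than `k` nonzero parts, its label is not that of a `k`-particle state, but
      -- then its coefficient vanishes
      by_cases hcol : column mu 1 ≤ k
      · rw [map_smul, opB_fockBasis (by omega) (hu 0) hmu hcol, Finset.smul_sum]
        refine Finset.sum_congr rfl fun lam hlam => ?_
        rw [minor_geom _ (mem_boxPartitions.1 hmu).2 (mem_boxPartitions.1 hlam).2]
        split_ifs
        · rw [smul_smul, Fin.prod_univ_succ, mul_zpow]
          congr 1
          ring
        · simp
      · rw [minor_prod_geom_eq_zero hmu _ (not_le.1 hcol)]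
        simp
    rw [Finset.sum_congr rfl h2, Finset.sum_comm]
    refine Finset.sum_congr rfl fun lam hlam => ?_
    rw [← Finset.sum_smul, ← Finset.mul_sum, ← minor_mul _ _ _ hlam]
    congr 3
    rw [Fin.prod_univ_succ, mul_comm]

/-- The scalar product as a sum of products of Schur polynomials. -/
theorem scalarProduct_eq_sum_schur {N M : ℕ} (u v : Fin N → ℂ) (hu : ∀ j, u j ≠ 0)
    (hv : ∀ j, v j ≠ 0) :
    (∏ j, u j / v j) ^ M * scalarProduct N M u v =
      ∑ lam ∈ boxPartitions N M,
        schur lam (fun j => u j ^ 2) * schur lam (fun j => (v j ^ 2)⁻¹) := by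
  have hpu : ∏ j, u j ≠ 0 := Finset.prod_ne_zero_iff.2 fun j _ => hu j
  have hpv : ∏ j, v j ≠ 0 := Finset.prod_ne_zero_iff.2 fun j _ => hv j
  rw [scalarProduct_eq_toDual, stateKet_eq_sum le_rfl u hu,
    stateKet_eq_sum le_rfl (fun j => (v j)⁻¹) fun j => inv_ne_zero (hv j), map_sum,
    Finset.mul_sum]
  refine Finset.sum_congr rfl fun lam hlam => ?_
  rw [map_sum, LinearMap.sum_apply, Finset.sum_eq_single_of_mem lam hlam]
  · rw [map_smul, map_smul, LinearMap.smul_apply, Module.Basis.toDual_apply, if_pos rfl,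
      schur_eq_minor hlam, schur_eq_minor hlam, Finset.prod_div_distrib, Finset.prod_inv_distrib]
    simp only [inv_pow, smul_eq_mul, zpow_neg, zpow_natCast, inv_inv, div_pow]
    field_simp
  · intro mu hmu hne
    rw [map_smul, map_smul, LinearMap.smul_apply, Module.Basis.toDual_apply,
      if_neg fun h => hne (occupation_injective hmu hlam h)]
    simp

end PhaseModel

namespace Toda

/-! ### The restricted `τ`-function -/

lemma restrictedTau_eq_sum_schur {N M : ℕ} {m n s : ℤ} (hn : n = m + ((N + M : ℕ) : ℤ))
    (hs : s = m + N) (A : Mat m n)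
    (hA : ∀ lam ∈ boxPartitions N M, ∀ mu ∈ boxPartitions N M,
      coefficient A lam mu = if lam = mu then 1 else 0) (a b : Fin N → ℂ) :
    restrictedTau A s a b = ∑ lam ∈ boxPartitions N M, schur lam a * schur lam b := by
  -- an inequality only because `numTimes m n` is `0`, not `-1`, when `N = M = 0`
  have hr : N + M ≤ numTimes m n + 1 := by unfold numTimes; omega
  rw [restrictedTau, tau_eq_sum_character hn hs A hA, neg_neg]
  refine Finset.sum_congr rfl fun lam hlam => ?_
  rw [character_powerSumTimes hlam hr, character_powerSumTimes hlam hr]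

open Classical in
/-- The polynomial `∑_λ S_λ(a) S_λ(b)` in two sets of variables. -/
def schurSumPolynomial (N M : ℕ) : MvPolynomial (Fin N ⊕ Fin N) ℂ :=
  ∑ lam ∈ boxPartitions N M,
    (∑ T ∈ (Finset.univ : Finset (Cell lam → Fin N)).filter IsSemistandard,
      ∏ c, MvPolynomial.X (Sum.inl (T c))) *
    ∑ T ∈ (Finset.univ : Finset (Cell lam → Fin N)).filter IsSemistandard,
      ∏ c, MvPolynomial.X (Sum.inr (T c))

lemma eval_schurSumPolynomial (N M : ℕ) (c : Fin N ⊕ Fin N → ℂ) :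
    MvPolynomial.eval c (schurSumPolynomial N M) =
      ∑ lam ∈ boxPartitions N M, schur lam (c ∘ Sum.inl) * schur lam (c ∘ Sum.inr) := by
  simp only [schurSumPolynomial, schur, map_sum, map_mul, map_prod, MvPolynomial.eval_X,
    Function.comp_apply]

lemma rename_schurSumPolynomial (N M : ℕ) (σ ρ : Equiv.Perm (Fin N)) :
    MvPolynomial.rename (Sum.map σ ρ) (schurSumPolynomial N M) = schurSumPolynomial N M := by
  refine MvPolynomial.funext fun c => ?_
  rw [MvPolynomial.eval_rename, eval_schurSumPolynomial, eval_schurSumPolynomial]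
  refine Finset.sum_congr rfl fun lam hlam => ?_
  rw [← schur_comp_perm hlam (c ∘ Sum.inl) σ, ← schur_comp_perm hlam (c ∘ Sum.inr) ρ]
  rfl

end Toda

end

theorem proposition2 (N M : ℕ) (m n s : ℤ) (hsn : s = n - (M : ℤ)) (hsm : s = m + (N : ℤ)) :
    -- initial data with `A_{λμ} = δ_{λμ}` exist
    (∃ A : Toda.Mat m n, Toda.IsInitialData A ∧
      ∀ lam ∈ Toda.boxPartitions N M, ∀ mu ∈ Toda.boxPartitions N M,
        Toda.coefficient A lam mu = if lam = mu then 1 else 0) ∧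
    -- the character polynomials restrict to Schur polynomials
    (∀ lam ∈ Toda.boxPartitions N M, ∀ a : Fin N → ℂ,
      Toda.character (Toda.numTimes m n) lam (Toda.powerSumTimes a) = Toda.schur lam a) ∧
    ∀ A : Toda.Mat m n, Toda.IsInitialData A →
      (∀ lam ∈ Toda.boxPartitions N M, ∀ mu ∈ Toda.boxPartitions N M,
        Toda.coefficient A lam mu = if lam = mu then 1 else 0) →
      -- the unrestricted function
      (∀ x y : ℕ → ℂ, Toda.tau A s x y =
        ∑ lam ∈ Toda.boxPartitions N M,
          Toda.character (Toda.numTimes m n) lam x *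
            Toda.character (Toda.numTimes m n) lam (-y)) ∧
      -- the restricted function is a polynomial, symmetric in each of the two sets of variables
      (∃ P : MvPolynomial (Fin N ⊕ Fin N) ℂ,
        (∀ σ ρ : Equiv.Perm (Fin N), MvPolynomial.rename (Sum.map σ ρ) P = P) ∧
        ∀ a b : Fin N → ℂ,
          Toda.restrictedTau A s a b = MvPolynomial.eval (Sum.elim a b) P) ∧
      -- the restricted function as a sum of products of Schur polynomials
      (∀ a b : Fin N → ℂ, Toda.restrictedTau A s a b =
        ∑ lam ∈ Toda.boxPartitions N M, Toda.schur lam a * Toda.schur lam b) ∧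
      -- the scalar product of the phase model
      ∀ u v : Fin N → ℂ, (∀ j, u j ≠ 0) → (∀ j, v j ≠ 0) →
        (∏ j, u j / v j) ^ M * PhaseModel.scalarProduct N M u v =
          Toda.restrictedTau A s (fun j => u j ^ 2) (fun j => (v j ^ 2)⁻¹) := by
  have hn : n = m + ((N + M : ℕ) : ℤ) := by push_cast; omega
  have hr : N + M ≤ Toda.numTimes m n + 1 := by unfold Toda.numTimes; omega
  refine ⟨⟨1, Toda.isInitialData_one m n, fun lam hlam mu hmu => Toda.coefficient_one hn hlam hmu⟩,
    fun lam hlam a => Toda.character_powerSumTimes hlam hr a, fun A _ hA => ?_⟩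
  have hrestr := Toda.restrictedTau_eq_sum_schur hn hsm A hA
  refine ⟨Toda.tau_eq_sum_character hn hsm A hA, ⟨Toda.schurSumPolynomial N M,
    Toda.rename_schurSumPolynomial N M, fun a b => ?_⟩, hrestr, fun u v hu hv => ?_⟩
  · rw [hrestr, Toda.eval_schurSumPolynomial]
    rfl
  · rw [hrestr, PhaseModel.scalarProduct_eq_sum_schur u v hu hv]
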